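/- **Conventions.** For a nonzero unital ring $R$, let $R^m$ ($m\ge 0$) and $R^\infty=\bigcup_m R^m$ be the free right $R$-modules of (finitely supported) column vectors, with standard basis $e_1,e_2,\dots$. A finite sequence $(v_1,\dots,v_k)$ of vectors in a right module $M$ is *unimodular* if it is an ordered basis of a free direct summand of $M$. The ring $R$ satisfies $(SR_l)$ if for every $l'\ge l$ and every unimodular vector $(r_1,\dots,r_{l'})\in R^{l'}$ there are $t_1,\dots,t_{l'-1}\in R$ such that $(r_1+t_1r_{l'},\dots,r_{l'-1}+t_{l'-1}r_{l'})\in R^{l'-1}$ is unimodular. The stable rank $\mathrm{sr}(R)\in[1,\infty]$ is the least $l\ge1$ such that $(SR_{l+1})$ holds, and $\infty$ if there is none. For a set $X$ let $\mathcal O(X)$ be the poset of sequences of length $\ge 1$ of distinct elements of $X$, ordered by the subsequence relation, and let $\mathcal U(M)\subseteq\mathcal O(M)$ be the subposet of unimodular sequences in $M$. For $F\subseteq \mathcal O(M)$ and $v=(v_1,\dots,v_k)\in F$ let $F_v$ be the set of sequences $(w_1,\dots,w_m)$, $m\ge1$, with $(w_1,\dots,w_m,v_1,\dots,v_k)\in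 F$. For a poset $P$ let $C_*(P;\mathbb R)$ be the real simplicial chain complex of its order complex (the $q$-simplices are the flags $x_0<\dots<x_q$), with the $\ell^1$-norm. It satisfies the *$q$-uniform boundary condition* ($q$-UBC) with constant $K$ if every boundary $c\in C_q(P;\mathbb R)$ is of the form $c=\partial b$ with $\|b\|\le K\|c\|$. For an integer $d\ge -1$, $P$ is *uniformly $d$-acyclic* if it is non-empty, its reduced real homology vanishes in all degrees $0\le q\le d$, and it satisfies the $q$-UBC with some constant for every $q\le d$. For $d<-1$ the condition is empty. **Theorem.** There are functions $K^{(1)},K^{(3)}:\mathbb N^2\to\mathbb R$ and $K^{(2)},K^{(4)}:\mathbb N^3\to\mathbb R$ such that for every nonzero unital ring $R$ of finite stable rank $s=\mathrm{sr}(R)$, every $n\ge0$ and every $\delta\in\{0,1\}$ the following holds. 1. $\mathcal O(R^n+\delta e_{n+1})\cap\mathcal U(R^\infty)$ is uniformly $(n-s-1)$-acyclic, and its UBC constant in all degrees $q\le n-s-1$ can be chosen as $K^{(1)}(n,s)$. 2. For every $v=(v_1,\dots,v_k)\in\mathcal U(R^\infty)$, $\mathcal O(R^n+\delta e_{n+1})\cap\mathcal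 U(R^\infty)_v$ is uniformly $(n-s-1-k)$-acyclic, and its UBC constant in all degrees $q\le n-s-1-k$ can be chosen as $K^{(2)}(n,s,k)$. 3. $\mathcal O\big((R^n+\delta e_{n+1})\cup(R^n+\delta e_{n+1}+e_{n+2})\big)\cap\mathcal U(R^\infty)$ is uniformly $(n-s)$-acyclic, and its UBC constant in all degrees $q\le n-s$ can be chosen as $K^{(3)}(n,s)$. 4. For every $v=(v_1,\dots,v_k)\in\mathcal U(R^\infty)$, $\mathcal O\big((R^n+\delta e_{n+1})\cup(R^n+\delta e_{n+1}+e_{n+2})\big)\cap\mathcal U(R^\infty)_v$ is uniformly $(n-s-k)$-acyclic, and its UBC constant in all degrees $q\le n-s-k$ can be chosen as $K^{(4)}(n,s,k)$. In particular, $\mathcal U(R^n)$ is uniformly $(n-s-1)$-acyclic, and its UBC constant in all degrees $q\le n-s-1$ can be chosen as $K^{(1)}(n,s)$. -/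

import Mathlib

universe u

noncomputable section

namespace UniformAcyclicity

/-! ### Normed simplicial chains of the order complex of a poset -/

section OrderComplex

variable (P : Type*) [PartialOrder P]

/-- The `q`-simplices of the order complex of `P`: flags `x₀ < ⋯ < x_q` in `P`. -/
def Simplices (q : ℕ) : Type _ := {x : Fin (q + 1) → P // StrictMono x}

/-- The real simplicial chains in degree `q ≥ 0`. -/
abbrev Chains (q : ℕ) : Type _ := Simplices P q →₀ ℝ

variable {P}

/-- The `i`-th face of a flag, omitting the entry `x i`. -/
def face {q : ℕ} (i : Fin (q + 2)) (x : Simplices P (q + 1)) : Simplices P q :=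
  ⟨fun j => x.1 (i.succAbove j), x.2.comp (Fin.strictMono_succAbove i)⟩

/-- The `ℓ¹`-norm of a chain. -/
def l1Norm {q : ℕ} (c : Chains P q) : ℝ := c.sum fun _ a => |a|

variable (P)

/-- The boundary map from degree `q + 1` to degree `q`: the alternating sum of the faces. -/
def boundary (q : ℕ) : Chains P (q + 1) →ₗ[ℝ] Chains P q :=
  Finsupp.lsum ℝ fun x => LinearMap.toSpanSingleton ℝ (Chains P q)
    (∑ i : Fin (q + 2), (-1 : ℝ) ^ (i : ℕ) • Finsupp.single (face i x) (1 : ℝ))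

/-- The augmentation, which sends every vertex to `1`; it is the boundary map from degree `0`
to degree `-1` of the reduced chain complex. -/
def augmentation : Chains P 0 →ₗ[ℝ] ℝ := Finsupp.lsum ℝ fun _ => LinearMap.id

/-- The cycles in degree `q ≥ 0` of the reduced simplicial chain complex. -/
def reducedCycles : (q : ℕ) → Submodule ℝ (Chains P q)
  | 0 => LinearMap.ker (augmentation P)
  | q + 1 => LinearMap.ker (boundary P q)

/-- The boundaries in degree `q ≥ 0`. -/
def boundaries (q : ℕ) : Submodule ℝ (Chains P q) := LinearMap.range (boundary P q)

/-- The reduced real simplicial homology in degree `q ≥ 0`, the quotient of the cycles by the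
boundaries, vanishes: every cycle is a boundary. -/
def ReducedHomologyVanishes (q : ℕ) : Prop := reducedCycles P q ≤ boundaries P q

/-- The `q`-uniform boundary condition with constant `K` for the simplicial chain complex.
In negative degrees this complex vanishes, so that the condition has content only for `q ≥ 0`. -/
def UBC (q : ℕ) (K : ℝ) : Prop :=
  ∀ c ∈ boundaries P q, ∃ b : Chains P (q + 1), boundary P q b = c ∧ l1Norm b ≤ K * l1Norm c

/-- Uniform `d`-acyclicity. For `d = -1` it says that `P` is non-empty, and for `d < -1` it is an
empty condition. -/
def UniformlyAcyclic (d : ℤ) : Prop :=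
  -1 ≤ d → Nonempty P ∧
    ∀ q : ℕ, (q : ℤ) ≤ d → ReducedHomologyVanishes P q ∧ ∃ K : ℝ, UBC P q K

/-- Uniform `d`-acyclicity such that the constant of the uniform boundary condition can be chosen
to be `K` in all degrees `q ≤ d`. -/
def UniformlyAcyclicWith (d : ℤ) (K : ℝ) : Prop :=
  UniformlyAcyclic P d ∧ ∀ q : ℕ, (q : ℤ) ≤ d → UBC P q K

end OrderComplex

/-! ### Posets of ordered sequences -/

/-- Non-empty finite sequences of distinct elements of `V`. -/
structure OrderedSeq (V : Type*) where
  toList : List V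
  ne_nil : toList ≠ []
  nodup : toList.Nodup

/-- `w ≤ s` if `w` is a subsequence of `s`, that is, if it arises by omitting elements of `s`. -/
instance (V : Type*) : PartialOrder (OrderedSeq V) where
  le w s := w.toList.Sublist s.toList
  le_refl w := List.Sublist.refl w.toList
  le_trans _ _ _ h h' := h.trans h'
  le_antisymm := by
    rintro ⟨a, _, _⟩ ⟨b, _, _⟩ h h'
    have : a = b := h.antisymm h'
    subst this
    rfl

/-- `𝒪(X)` for a subset `X` of `V`: all sequences with entries in `X`. -/
def orderedSeqs {V : Type*} (X : Set V) : Set (OrderedSeq V) := {w | ∀ x ∈ w.toList, x ∈ X}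

/-- `F_v`: the sequences `w` such that the concatenation `(w, v)` belongs to `F`. -/
def appendLink {V : Type*} (F : Set (OrderedSeq V)) (v : OrderedSeq V) : Set (OrderedSeq V) :=
  {w | ∃ u ∈ F, u.toList = w.toList ++ v.toList}

/-! ### Unimodular sequences and stable rank

Modules are right modules, that is, modules over the opposite ring: column vectors over `R` are
multiplied by scalars from the right, and matrices over `R` act on them from the left. -/

/-- A sequence of vectors is unimodular if it is an ordered basis of a free direct summand. -/
def IsUnimodular (R : Type*) {M : Type*} [Ring R] [AddCommGroup M] [Module Rᵐᵒᵖ M]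
    (l : List M) : Prop :=
  LinearIndependent Rᵐᵒᵖ l.get ∧
    ∃ Q : Submodule Rᵐᵒᵖ M, IsCompl (Submodule.span Rᵐᵒᵖ {x | x ∈ l}) Q

/-- `𝒰(M)`: the unimodular sequences in the right `R`-module `M`. -/
def unimodularSeqs (R : Type*) (M : Type*) [Ring R] [AddCommGroup M] [Module Rᵐᵒᵖ M] :
    Set (OrderedSeq M) := {w | IsUnimodular R w.toList}

/-- Bass' stable range condition `(SR_l)`: every unimodular column of length `m + 1 ≥ l` can be
shortened to a unimodular one by adding left multiples of its last entry to the others. -/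
def StableRange (R : Type*) [Ring R] (l : ℕ) : Prop :=
  ∀ m : ℕ, l ≤ m + 1 → ∀ r : Fin (m + 1) → R, IsUnimodular R [r] →
    ∃ t : Fin m → R, IsUnimodular R [fun i : Fin m => r i.castSucc + t i * r (Fin.last m)]

/-- The stable rank: the least `l ≥ 1` such that `(SR_{l + 1})` holds, and `∞` if there is none. -/
def stableRank (R : Type*) [Ring R] : ℕ∞ :=
  sInf {s : ℕ∞ | ∃ l : ℕ, s = l ∧ 1 ≤ l ∧ StableRange R (l + 1)}

/-- The coset `R^n + δ e_{n+1}` in `R^∞`, the finitely supported functions `ℕ → R`. The standard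
basis vectors `e₁, e₂, …` are `single 0 1, single 1 1, …`. -/
def coset (R : Type*) [Ring R] (n : ℕ) (δ : R) : Set (ℕ →₀ R) :=
  {x | ∃ v ∈ Finsupp.supported R Rᵐᵒᵖ {i : ℕ | i < n}, x = v + Finsupp.single n δ}

/-- The union of the two cosets `R^n + δ e_{n+1}` and `R^n + δ e_{n+1} + e_{n+2}`. -/
def twoCosets (R : Type*) [Ring R] (n : ℕ) (δ : R) : Set (ℕ →₀ R) :=
  coset R n δ ∪ {x | ∃ y ∈ coset R n δ, x = y + Finsupp.single (n + 1) 1}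

end UniformAcyclicity

end

/-!
Everything takes place in an algebraic model of the complexes: the chains are finitely supported
real functions on words (lists of vectors), the boundary is the alternating sum of the words that
omit one letter, and the empty word makes the complex augmented. Vanishing of reduced homology in
degree `p - 1` together with the uniform boundary condition becomes the single property `Fillable`:
every cycle of words of length `p` bounds a chain of controlled norm.

*From words to the order complex.* The order complex of a poset of sequences is the barycentric
subdivision of the complex of words. Replacing every word of a flag by its first letter is a chain
map `headsMap` to the complex of words, and the subdivision map goes back. The composite on flags
is homotopic to the identity by `flagHomotopy`, which comes from the cones over the largest words
of flags; all norms are bounded in terms of the degree. Hence `fillable_flagsOf`, and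
`uniformlyAcyclicWith_of_fillable` translates the result into simplicial chains.

*Two gluing lemmas.* Let `X` be a set of letters and write a word as `(u, v)`, where `u` is its
longest prefix with letters in `X`. Filtering by the length of `v`, the graded pieces are sums of
complexes of links in `X` of the words `v` that start outside `X`. So fillings of these links reduce
every cycle to words with letters in `X` (`fillable_of_links`). If a letter `y` can be appended to
all words with letters in `X`, these words together with those ending in `y` form a cone, and
no assumption on `X` itself is needed (`fillable_of_cone`).

*Unimodular sequences.* A sequence is unimodular iff it has distinct entries and a dual family of
functionals. Working modulo a set `Z` on which all functionals vanish, a vector `v` with a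
functional `θ` such that `θ v = 1` can be moved from a unimodular sequence to `Z`
(`unimodularMod_append_cons_iff`), which replaces coordinate changes and quotient modules. For
cosets of a submodule with basis `f` and dual functionals, an induction over the rank `n` treats
one coset and two parallel cosets, with arbitrary links, simultaneously (`exists_fillable`):
one coset of rank `n + 1` contains two cosets of rank `n`, separated by the last coordinate; two
cosets without a link contain a cone over the first one, with apex in the second one; and for two
cosets with a link, the stable range condition, applied twice, splits the first vector of the link
off at the expense of one rank (`SplitBasis.exists_split_off`). The only case with too small a rank
for this is the non-emptiness of the link of a single vector, where one application of the stable
range condition suffices (`twoCosetFillable_one_zero`).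
-/

noncomputable section

namespace UniformAcyclicity

/-! ### The `ℓ¹`-norm of finitely supported functions -/

section Norm

variable {α β : Type*}

/-- The `ℓ¹`-norm of a finitely supported function. -/
def l1 (c : α →₀ ℝ) : ℝ := c.sum fun _ a => |a|

lemma l1_eq_sum_of_subset {c : α →₀ ℝ} {s : Finset α} (h : c.support ⊆ s) :
    l1 c = ∑ a ∈ s, |c a| :=
  Finsupp.sum_of_support_subset c h _ (by simp)

lemma l1_nonneg (c : α →₀ ℝ) : 0 ≤ l1 c := Finset.sum_nonneg fun _ _ => abs_nonneg _

@[simp] lemma l1_zero : l1 (0 : α →₀ ℝ) = 0 := by simp [l1]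

@[simp] lemma l1_single (a : α) (r : ℝ) : l1 (Finsupp.single a r) = |r| := by simp [l1]

lemma l1_add_le (c c' : α →₀ ℝ) : l1 (c + c') ≤ l1 c + l1 c' := by
  classical
  rw [l1_eq_sum_of_subset (Finsupp.support_add (g₁ := c) (g₂ := c')),
    l1_eq_sum_of_subset (c := c) (Finset.subset_union_left (s₂ := c'.support)),
    l1_eq_sum_of_subset (c := c') (Finset.subset_union_right (s₁ := c.support)),
    ← Finset.sum_add_distrib]
  exact Finset.sum_le_sum fun a _ => abs_add_le _ _

lemma l1_smul (r : ℝ) (c : α →₀ ℝ) : l1 (r • c) = |r| * l1 c := by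
  rw [l1_eq_sum_of_subset (Finsupp.support_smul (b := r) (g := c)), l1, Finsupp.sum,
    Finset.mul_sum]
  simp [abs_mul]

lemma l1_neg (c : α →₀ ℝ) : l1 (-c) = l1 c := by
  have := l1_smul (-1) c
  simpa using this

lemma l1_sub_le (c c' : α →₀ ℝ) : l1 (c - c') ≤ l1 c + l1 c' := by
  rw [sub_eq_add_neg, ← l1_neg c']
  exact l1_add_le _ _

lemma l1_sum_le {ι : Type*} (s : Finset ι) (c : ι → α →₀ ℝ) :
    l1 (∑ i ∈ s, c i) ≤ ∑ i ∈ s, l1 (c i) :=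
  Finset.le_sum_of_subadditive l1 l1_zero.le l1_add_le s c

lemma map_eq_sum {N : Type*} [AddCommGroup N] [Module ℝ N] (T : (α →₀ ℝ) →ₗ[ℝ] N) (c : α →₀ ℝ) :
    T c = ∑ w ∈ c.support, c w • T (Finsupp.single w 1) := by
  conv_lhs => rw [← Finsupp.sum_single c, Finsupp.sum, map_sum]
  refine Finset.sum_congr rfl fun w _ => ?_
  rw [← map_smul, Finsupp.smul_single_one]

lemma l1_map_le (T : (α →₀ ℝ) →ₗ[ℝ] (β →₀ ℝ)) {C : ℝ} {c : α →₀ ℝ}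
    (h : ∀ w ∈ c.support, l1 (T (Finsupp.single w 1)) ≤ C) : l1 (T c) ≤ C * l1 c := by
  rw [map_eq_sum]
  refine (l1_sum_le _ _).trans ?_
  rw [l1, Finsupp.sum, Finset.mul_sum]
  refine Finset.sum_le_sum fun w hw => ?_
  rw [l1_smul, mul_comm]
  exact mul_le_mul_of_nonneg_right (h w hw) (abs_nonneg _)

lemma map_mem_of_supported {N : Type*} [AddCommGroup N] [Module ℝ N]
    (T : (α →₀ ℝ) →ₗ[ℝ] N) {S : Set α} {W : Submodule ℝ N}
    (h : ∀ w ∈ S, T (Finsupp.single w 1) ∈ W) {c : α →₀ ℝ}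
    (hc : c ∈ Finsupp.supported ℝ ℝ S) : T c ∈ W := by
  rw [map_eq_sum]
  exact W.sum_mem fun w hw => W.smul_mem _ (h w (hc hw))

lemma map_eq_of_supported {N : Type*} [AddCommGroup N] [Module ℝ N]
    (T T' : (α →₀ ℝ) →ₗ[ℝ] N) {S : Set α}
    (h : ∀ w ∈ S, T (Finsupp.single w 1) = T' (Finsupp.single w 1)) {c : α →₀ ℝ}
    (hc : c ∈ Finsupp.supported ℝ ℝ S) : T c = T' c := by
  rw [map_eq_sum, map_eq_sum T']
  exact Finset.sum_congr rfl fun w hw => by rw [h w (hc hw)]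

lemma map_eq_zero_of_supported {N : Type*} [AddCommGroup N] [Module ℝ N]
    (T : (α →₀ ℝ) →ₗ[ℝ] N) {S : Set α} (h : ∀ w ∈ S, T (Finsupp.single w 1) = 0) {c : α →₀ ℝ}
    (hc : c ∈ Finsupp.supported ℝ ℝ S) : T c = 0 :=
  map_eq_of_supported T 0 h hc

lemma single_mem_supported {S : Set α} {a : α} (h : a ∈ S) (r : ℝ) :
    Finsupp.single a r ∈ Finsupp.supported ℝ ℝ S :=
  Finsupp.single_mem_supported ℝ r h

end Norm

/-! ### The complex of words -/

section Words

variable {V : Type*}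

/-- The map of chains that puts the letter `x` in front of every word. -/
def consMap (x : V) : (List V →₀ ℝ) →ₗ[ℝ] (List V →₀ ℝ) := Finsupp.lmapDomain ℝ ℝ (List.cons x)

/-- The map of chains that puts the word `u` in front of every word. -/
def prependMap (u : List V) : (List V →₀ ℝ) →ₗ[ℝ] (List V →₀ ℝ) :=
  Finsupp.lmapDomain ℝ ℝ (u ++ ·)

/-- The map of chains that appends the word `v` to every word. -/
def appendMap (v : List V) : (List V →₀ ℝ) →ₗ[ℝ] (List V →₀ ℝ) :=
  Finsupp.lmapDomain ℝ ℝ (· ++ v)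

@[simp] lemma consMap_single (x : V) (w : List V) (r : ℝ) :
    consMap x (Finsupp.single w r) = Finsupp.single (x :: w) r := by simp [consMap]

@[simp] lemma prependMap_single (u w : List V) (r : ℝ) :
    prependMap u (Finsupp.single w r) = Finsupp.single (u ++ w) r := by simp [prependMap]

@[simp] lemma appendMap_single (v w : List V) (r : ℝ) :
    appendMap v (Finsupp.single w r) = Finsupp.single (w ++ v) r := by simp [appendMap]

/-- The boundary of a word: the alternating sum of the words that omit one letter. A word of
length one has the empty word as its boundary, so that the complex of words is augmented. -/
def wordBoundary : List V → (List V →₀ ℝ)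
  | [] => 0
  | x :: w => Finsupp.single w 1 - consMap x (wordBoundary w)

/-- The boundary map of the complex of words; the degree of a word is its length minus one. -/
def dWord : (List V →₀ ℝ) →ₗ[ℝ] (List V →₀ ℝ) := Finsupp.linearCombination ℝ wordBoundary

@[simp] lemma dWord_single (w : List V) (r : ℝ) :
    dWord (Finsupp.single w r) = r • wordBoundary w := by simp [dWord]

lemma dWord_consMap (x : V) (c : List V →₀ ℝ) : dWord (consMap x c) = c - consMap x (dWord c) := by
  have : dWord ∘ₗ consMap x = LinearMap.id - consMap x ∘ₗ dWord := by
    ext w : 2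
    simp [wordBoundary]
  exact LinearMap.congr_fun this c

lemma dWord_wordBoundary (w : List V) : dWord (wordBoundary w) = 0 := by
  induction w with
  | nil => simp [wordBoundary]
  | cons x w ih => simp [wordBoundary, dWord_consMap, ih]

lemma dWord_dWord (c : List V →₀ ℝ) : dWord (dWord c) = 0 := by
  have : dWord ∘ₗ dWord = (0 : (List V →₀ ℝ) →ₗ[ℝ] (List V →₀ ℝ)) := by
    ext w : 2
    simp [dWord_wordBoundary]
  exact LinearMap.congr_fun this c

lemma wordBoundary_append (u v : List V) :
    wordBoundary (u ++ v) =
      appendMap v (wordBoundary u) + (-1 : ℝ) ^ u.length • prependMap u (wordBoundary v) := by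
  induction u with
  | nil =>
    simp only [wordBoundary, prependMap, List.nil_append, map_zero, zero_add, List.length_nil,
      pow_zero, one_smul, Finsupp.lmapDomain_apply]
    exact Finsupp.mapDomain_id.symm
  | cons x u ih =>
    have h1 : ∀ c : List V →₀ ℝ, consMap x (appendMap v c) = appendMap v (consMap x c) := by
      intro c
      simp [consMap, appendMap, ← Finsupp.mapDomain_comp, Function.comp_def]
    have h2 : ∀ c : List V →₀ ℝ, consMap x (prependMap u c) = prependMap (x :: u) c := by
      intro c
      simp [consMap, prependMap, ← Finsupp.mapDomain_comp, Function.comp_def]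
    simp only [List.cons_append, wordBoundary, ih, map_add, map_smul, h1, h2, map_sub,
      appendMap_single, List.length_cons, pow_succ]
    module

lemma wordBoundary_mem (w : List V) : wordBoundary w ∈
    Finsupp.supported ℝ ℝ {w' : List V | w'.Sublist w ∧ w'.length + 1 = w.length} := by
  induction w with
  | nil => exact Submodule.zero_mem _
  | cons x w ih =>
    refine Submodule.sub_mem _ ?_ ?_
    · apply single_mem_supported
      exact ⟨List.sublist_cons_self x w, rfl⟩
    refine map_mem_of_supported _ (fun w' hw' => ?_) ih
    rw [consMap_single]
    apply single_mem_supported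
    exact ⟨hw'.1.cons_cons x, by simpa using hw'.2⟩

lemma l1_wordBoundary_le (w : List V) : l1 (wordBoundary w) ≤ w.length := by
  induction w with
  | nil => simp [wordBoundary]
  | cons x w ih =>
    refine (l1_sub_le _ _).trans ?_
    have : l1 (consMap x (wordBoundary w)) ≤ 1 * l1 (wordBoundary w) :=
      l1_map_le _ fun w' _ => by simp
    rw [l1_single, abs_one, List.length_cons, Nat.cast_succ]
    linarith

/-- The chains that are supported on words of length `p` in `F`. -/
def chainsOn (F : Set (List V)) (p : ℕ) : Submodule ℝ (List V →₀ ℝ) :=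
  Finsupp.supported ℝ ℝ {w | w ∈ F ∧ w.length = p}

/-- Closure of a set of words under subsequences (the chain condition). -/
def SublistClosed (F : Set (List V)) : Prop := ∀ w ∈ F, ∀ w', w'.Sublist w → w' ∈ F

/-- Uniform acyclicity of the complex of words of `F` at the words of length `p`: every cycle `c`
is the boundary of a chain of norm at most `K * ‖c‖`. This combines the vanishing of the reduced
homology in degree `p - 1` with the uniform boundary condition. -/
def Fillable (F : Set (List V)) (p : ℕ) (K : ℝ) : Prop :=
  ∀ c ∈ chainsOn F p, dWord c = 0 → ∃ b ∈ chainsOn F (p + 1), dWord b = c ∧ l1 b ≤ K * l1 c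

lemma Fillable.mono {F : Set (List V)} {p : ℕ} {K K' : ℝ} (h : Fillable F p K) (hK : K ≤ K') :
    Fillable F p K' := by
  intro c hc hd
  obtain ⟨b, hb, hbc, hn⟩ := h c hc hd
  exact ⟨b, hb, hbc, hn.trans (mul_le_mul_of_nonneg_right hK (l1_nonneg c))⟩

lemma dWord_mem_chainsOn {F : Set (List V)} (hF : SublistClosed F) {p : ℕ} {c : List V →₀ ℝ}
    (hc : c ∈ chainsOn F (p + 1)) : dWord c ∈ chainsOn F p := by
  refine map_mem_of_supported _ (fun w hw => ?_) hc
  rw [dWord_single, one_smul]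
  refine Finsupp.supported_mono ?_ (wordBoundary_mem w)
  intro w' hw'
  exact ⟨hF w hw.1 w' hw'.1, by have := hw.2; have := hw'.2; omega⟩

lemma l1_dWord_le {F : Set (List V)} {p : ℕ} {c : List V →₀ ℝ} (hc : c ∈ chainsOn F p) :
    l1 (dWord c) ≤ p * l1 c := by
  refine l1_map_le _ fun w hw => ?_
  rw [dWord_single, one_smul]
  refine (l1_wordBoundary_le w).trans ?_
  rw [(hc hw).2]

end Words

/-! ### Splitting words into a prefix in `X` and a suffix -/

section Suffix

open Classical in
/-- The longest prefix of a word with letters in `X`. -/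
def prefixIn {V : Type*} (X : Set V) (w : List V) : List V := w.takeWhile fun x => decide (x ∈ X)

open Classical in
/-- What remains of a word after removing its longest prefix with letters in `X`. -/
def suffixOff {V : Type*} (X : Set V) (w : List V) : List V := w.dropWhile fun x => decide (x ∈ X)

/-- The link in `X`: words with letters in `X` that can be put in front of `v` within `F`. -/
def linkIn {V : Type*} (F : Set (List V)) (X : Set V) (v : List V) : Set (List V) :=
  {u | (∀ x ∈ u, x ∈ X) ∧ u ++ v ∈ F}

variable {V : Type u} {X : Set V}

lemma prefixIn_append_suffixOff (w : List V) : prefixIn X w ++ suffixOff X w = w :=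
  List.takeWhile_append_dropWhile

lemma mem_of_mem_prefixIn {w : List V} {x : V} (h : x ∈ prefixIn X w) : x ∈ X := by
  classical
  simpa using List.mem_takeWhile_imp h

lemma suffixOff_append {u v : List V} (h : ∀ x ∈ u, x ∈ X) :
    suffixOff X (u ++ v) = suffixOff X v :=
  List.dropWhile_append_of_pos (by simpa using h)

lemma suffixOff_idem (w : List V) : suffixOff X (suffixOff X w) = suffixOff X w :=
  List.dropWhile_idempotent _ _

lemma length_suffixOff_le (w : List V) : (suffixOff X w).length ≤ w.length :=
  (List.dropWhile_sublist _).length_le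

lemma suffixOff_cons_of_notMem {x : V} (hx : x ∉ X) (v : List V) :
    suffixOff X (x :: v) = x :: v := by
  simp [suffixOff, hx]

lemma prefixIn_append_cons {u : List V} (h : ∀ x ∈ u, x ∈ X) {y : V} (hy : y ∉ X) (v : List V) :
    prefixIn X (u ++ y :: v) = u := by
  classical
  rw [prefixIn, List.takeWhile_append_of_pos (by simpa using h)]
  simp [hy]

lemma suffixOff_eq_nil_or (w : List V) :
    suffixOff X w = [] ∨ ∃ x v, suffixOff X w = x :: v ∧ x ∉ X := by
  induction w with
  | nil => exact Or.inl rfl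
  | cons a w ih =>
    by_cases ha : a ∈ X
    · have : suffixOff X (a :: w) = suffixOff X w := by simp [suffixOff, ha]
      rwa [this]
    · exact Or.inr ⟨a, w, suffixOff_cons_of_notMem ha w, ha⟩

lemma eq_nil_of_suffixOff {w : List V} (h : suffixOff X w = []) : ∀ x ∈ w, x ∈ X := by
  intro x hx
  rw [← prefixIn_append_suffixOff (X := X) w, h, List.append_nil] at hx
  exact mem_of_mem_prefixIn hx

open Classical in
/-- The coefficient of the suffix `v`: a word with suffix `v` is sent to its prefix, and all other
words are sent to `0`. -/
def suffixCoeff (X : Set V) (v : List V) : (List V →₀ ℝ) →ₗ[ℝ] (List V →₀ ℝ) :=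
  Finsupp.linearCombination ℝ fun w =>
    if suffixOff X w = v then Finsupp.single (prefixIn X w) 1 else 0

open Classical in
lemma suffixCoeff_single (v w : List V) : suffixCoeff X v (Finsupp.single w 1) =
    if suffixOff X w = v then Finsupp.single (prefixIn X w) 1 else 0 := by
  simp [suffixCoeff]

/-- On chains whose suffixes are no longer than `v`, the coefficient of `v` is a chain map: omitting
a letter of the suffix makes the suffix shorter. -/
lemma suffixCoeff_dWord {y : V} (hy : y ∉ X) (v : List V) {c : List V →₀ ℝ}
    (hc : ∀ w ∈ c.support, (suffixOff X w).length ≤ v.length + 1) :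
    suffixCoeff X (y :: v) (dWord c) = dWord (suffixCoeff X (y :: v) c) := by
  classical
  have key : (suffixCoeff X (y :: v) ∘ₗ dWord) c = (dWord ∘ₗ suffixCoeff X (y :: v)) c := by
    refine map_eq_of_supported (S := {w | (suffixOff X w).length ≤ v.length + 1}) _ _ ?_ hc
    intro w hw
    simp only [LinearMap.comp_apply, dWord_single, one_smul, suffixCoeff_single]
    obtain ⟨u, t, hu, ht, huw⟩ : ∃ u t, (∀ x ∈ u, x ∈ X) ∧ suffixOff X w = t ∧ u ++ t = w :=
      ⟨_, _, fun x hx => mem_of_mem_prefixIn hx, rfl, prefixIn_append_suffixOff (X := X) w⟩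
    have htt : suffixOff X t = t := by rw [← ht, suffixOff_idem]
    have hz : suffixCoeff X (y :: v) (prependMap u (wordBoundary t)) = 0 := by
      refine map_eq_zero_of_supported (suffixCoeff X (y :: v) ∘ₗ prependMap u)
        (fun t' ht' => ?_) (wordBoundary_mem t)
      simp only [LinearMap.comp_apply, prependMap_single, suffixCoeff_single]
      rw [if_neg]
      intro h
      rw [suffixOff_append hu] at h
      have h1 := length_suffixOff_le (X := X) t'
      rw [h] at h1
      have h2 : (suffixOff X w).length ≤ v.length + 1 := hw
      rw [ht] at h2
      have h3 : t'.length + 1 = t.length := ht'.2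
      simp only [List.length_cons] at h1
      omega
    have ha : suffixCoeff X (y :: v) (appendMap t (wordBoundary u)) =
        if t = y :: v then wordBoundary u else 0 := by
      have : (suffixCoeff X (y :: v) ∘ₗ appendMap t) (wordBoundary u) =
          (if t = y :: v then LinearMap.id else (0 : (List V →₀ ℝ) →ₗ[ℝ] _)) (wordBoundary u) := by
        refine map_eq_of_supported _ _ (fun u' hu' => ?_) (wordBoundary_mem u)
        have hu'' : ∀ x ∈ u', x ∈ X := fun x hx => hu x (hu'.1.subset hx)
        simp only [LinearMap.comp_apply, appendMap_single, suffixCoeff_single,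
          suffixOff_append hu'', htt]
        split_ifs with h
        · rw [h, prefixIn_append_cons hu'' hy]; rfl
        · rfl
      rw [← LinearMap.comp_apply, this]
      split_ifs <;> rfl
    rw [← huw, wordBoundary_append, map_add, map_smul, hz, smul_zero, add_zero, ha,
      suffixOff_append hu, htt]
    split_ifs with h
    · rw [h, prefixIn_append_cons hu hy, dWord_single, one_smul]
    · rw [map_zero]
  exact key

lemma sum_l1_suffixCoeff_le (T : Finset (List V)) (c : List V →₀ ℝ) :
    ∑ v ∈ T, l1 (suffixCoeff X v c) ≤ l1 c := by
  classical
  have h : ∀ v ∈ T, l1 (suffixCoeff X v c) ≤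
      ∑ w ∈ c.support, if suffixOff X w = v then |c w| else 0 := by
    intro v _
    rw [map_eq_sum]
    refine (l1_sum_le _ _).trans (Finset.sum_le_sum fun w _ => ?_)
    rw [l1_smul, suffixCoeff_single]
    split_ifs <;> simp
  refine (Finset.sum_le_sum h).trans ?_
  rw [Finset.sum_comm, l1, Finsupp.sum]
  refine Finset.sum_le_sum fun w _ => ?_
  rw [Finset.sum_ite_eq]
  split_ifs
  · exact le_rfl
  · exact abs_nonneg _

end Suffix

/-! ### Reduction to words with letters in `X` -/

section Reduction

/-- One step of the reduction: in a cycle whose suffixes have length at most `j + 1`, the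
coefficients of the suffixes of length `j + 1` are cycles in the links of these suffixes. Filling
them removes all those suffixes that do not belong to `E`. -/
lemma exists_shorten_suffix {V : Type u} {F : Set (List V)} {X : Set V} {E : Set (List V)}
    (hF : SublistClosed F) {p j : ℕ} {K : ℝ} (hK : 0 ≤ K)
    (hfill : ∀ x v, x ∉ X → x :: v ∈ F → x :: v ∉ E → v.length + 1 ≤ p →
      Fillable (linkIn F X (x :: v)) (p - (v.length + 1)) K)
    {c : List V →₀ ℝ} (hc : c ∈ chainsOn F p) (hd : dWord c = 0)
    (hs : ∀ w ∈ c.support, (suffixOff X w).length ≤ j + 1) :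
    ∃ b ∈ chainsOn F (p + 1), l1 b ≤ K * l1 c ∧
      ∀ w ∈ (c - dWord b).support, (suffixOff X w).length ≤ j ∨ suffixOff X w ∈ E := by
  classical
  set T : Finset (List V) :=
    (c.support.image (suffixOff X)).filter fun v => v.length = j + 1 ∧ v ∉ E with hT
  have hfillT : ∀ v ∈ T, ∃ b ∈ chainsOn (linkIn F X v) (p + 1 - v.length),
      dWord b = suffixCoeff X v c ∧ l1 b ≤ K * l1 (suffixCoeff X v c) ∧ v.length ≤ p := by
    intro v hv
    simp only [hT, Finset.mem_filter, Finset.mem_image] at hv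
    obtain ⟨⟨w, hw, hwv⟩, hlen, hvE⟩ := hv
    rcases suffixOff_eq_nil_or (X := X) w with h0 | ⟨x, v', hxv, hx⟩
    · rw [hwv] at h0; simp [h0] at hlen
    rw [hwv] at hxv
    subst hxv
    have hwF := (hc hw).1
    have hwp : w.length = p := (hc hw).2
    have hle : v'.length + 1 ≤ p := by
      have := length_suffixOff_le (X := X) w
      rw [hwv] at this
      simpa [hwp] using this
    have hvF : x :: v' ∈ F := by
      refine hF w hwF _ ?_
      rw [← hwv]
      exact List.dropWhile_sublist _
    simp only [List.length_cons, Nat.add_right_cancel_iff] at hlen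
    have hmem : suffixCoeff X (x :: v') c ∈
        chainsOn (linkIn F X (x :: v')) (p - (v'.length + 1)) := by
      refine map_mem_of_supported _ (fun w' hw' => ?_) hc
      rw [suffixCoeff_single]
      split_ifs with h
      · have h1 := prefixIn_append_suffixOff (X := X) w'
        apply single_mem_supported
        refine ⟨⟨fun _ => mem_of_mem_prefixIn, ?_⟩, ?_⟩
        · rw [← h, h1]; exact hw'.1
        · have h2 := congrArg List.length h1
          rw [h, List.length_append, List.length_cons, hw'.2] at h2
          omega
      · exact Submodule.zero_mem _
    have hcyc : dWord (suffixCoeff X (x :: v') c) = 0 := by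
      rw [← suffixCoeff_dWord hx v' (by rw [hlen]; exact hs), hd, map_zero]
    obtain ⟨b, hb, hbc, hbn⟩ := hfill x v' hx hvF hvE hle _ hmem hcyc
    refine ⟨b, ?_, hbc, hbn, by simpa using hle⟩
    have : p + 1 - (x :: v').length = p - (v'.length + 1) + 1 := by
      simp only [List.length_cons]; omega
    rwa [this]
  choose! β hβ hβd hβn hβl using hfillT
  refine ⟨∑ v ∈ T, appendMap v (β v), ?_, ?_, ?_⟩
  · refine Submodule.sum_mem _ fun v hv => ?_
    refine map_mem_of_supported _ (fun u hu => ?_) (hβ v hv)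
    rw [appendMap_single]
    apply single_mem_supported
    refine ⟨hu.1.2, ?_⟩
    have h1 : u.length = p + 1 - v.length := hu.2
    have h2 := hβl v hv
    rw [List.length_append, h1]
    omega
  · refine (l1_sum_le _ _).trans ?_
    have h1 : ∀ v ∈ T, l1 (appendMap v (β v)) ≤ K * l1 (suffixCoeff X v c) := fun v hv =>
      (l1_map_le (C := 1) _ fun w _ => by simp).trans (by rw [one_mul]; exact hβn v hv)
    refine (Finset.sum_le_sum h1).trans ?_
    rw [← Finset.mul_sum]
    exact mul_le_mul_of_nonneg_left (sum_l1_suffixCoeff_le T c) hK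
  · set W : Submodule ℝ (List V →₀ ℝ) :=
      Finsupp.supported ℝ ℝ {w | (suffixOff X w).length ≤ j ∨ suffixOff X w ∈ E} with hW
    suffices h : c - dWord (∑ v ∈ T, appendMap v (β v)) ∈ W from fun w hw => h hw
    have h1 : c - ∑ v ∈ T, appendMap v (suffixCoeff X v c) ∈ W := by
      have : (LinearMap.id - ∑ v ∈ T, appendMap v ∘ₗ suffixCoeff X v :
          (List V →₀ ℝ) →ₗ[ℝ] _) c ∈ W := by
        refine map_mem_of_supported (S := ↑c.support) _ (fun w hw => ?_)
          ((Finsupp.mem_supported ℝ c).2 subset_rfl)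
        have h2 : (∑ v ∈ T, appendMap v ∘ₗ suffixCoeff X v) (Finsupp.single w 1) =
            if suffixOff X w ∈ T then Finsupp.single w 1 else 0 := by
          rw [LinearMap.sum_apply,
            ← Finset.sum_ite_eq T (suffixOff X w) fun _ => Finsupp.single w 1]
          refine Finset.sum_congr rfl fun v _ => ?_
          rw [LinearMap.comp_apply, suffixCoeff_single]
          split_ifs with h
          · rw [appendMap_single, ← h, prefixIn_append_suffixOff]
          · rw [map_zero]
        rw [LinearMap.sub_apply, h2, LinearMap.id_apply]
        split_ifs with h
        · rw [sub_self]; exact Submodule.zero_mem _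
        · rw [sub_zero]
          apply single_mem_supported
          by_contra hcon
          simp only [Set.mem_ofPred_eq, not_or] at hcon
          apply h
          have := hs w hw
          rw [hT, Finset.mem_filter]
          exact ⟨Finset.mem_image_of_mem _ hw, by omega, hcon.2⟩
      simpa using this
    have h2 : ∀ v ∈ T, appendMap v (suffixCoeff X v c) - dWord (appendMap v (β v)) ∈ W := by
      intro v hv
      have hvl : v.length = j + 1 := ((Finset.mem_filter.1 hv).2).1
      rw [← hβd v hv]
      have : (appendMap v ∘ₗ dWord - dWord ∘ₗ appendMap v) (β v) ∈ W := by
        refine map_mem_of_supported _ (fun u hu => ?_) (hβ v hv)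
        have huX : ∀ x ∈ u, x ∈ X := hu.1.1
        simp only [LinearMap.sub_apply, LinearMap.comp_apply, dWord_single, appendMap_single,
          one_smul, wordBoundary_append, sub_add_cancel_left]
        refine Submodule.neg_mem _ (Submodule.smul_mem _ _ ?_)
        refine map_mem_of_supported _ (fun v' hv' => ?_) (wordBoundary_mem v)
        rw [prependMap_single]
        apply single_mem_supported
        left
        rw [suffixOff_append huX]
        have h3 := length_suffixOff_le (X := X) v'
        have h4 : v'.length + 1 = v.length := hv'.2
        omega
      simpa using this
    have h3 : c - dWord (∑ v ∈ T, appendMap v (β v)) =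
        (c - ∑ v ∈ T, appendMap v (suffixCoeff X v c)) +
          ∑ v ∈ T, (appendMap v (suffixCoeff X v c) - dWord (appendMap v (β v))) := by
      rw [map_sum, Finset.sum_sub_distrib]
      abel
    rw [h3]
    exact W.add_mem h1 (W.sum_mem h2)

/-- If the links in `X` of all words that start outside `X` and do not belong to `E` can be filled,
then every cycle is homologous to a cycle all of whose suffixes belong to `E`. -/
lemma exists_suffix_mem (p : ℕ) (K : ℝ) (hK : 0 ≤ K) : ∃ K' : ℝ, 0 ≤ K' ∧
    ∀ (V : Type u) (F : Set (List V)) (X : Set V) (E : Set (List V)), SublistClosed F →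
      [] ∈ E → (∀ e ∈ E, e.length ≤ 1) →
      (∀ x v, x ∉ X → x :: v ∈ F → x :: v ∉ E → v.length + 1 ≤ p →
        Fillable (linkIn F X (x :: v)) (p - (v.length + 1)) K) →
      ∀ c ∈ chainsOn F p, dWord c = 0 →
        ∃ b ∈ chainsOn F (p + 1), l1 b ≤ K' * l1 c ∧
          ∀ w ∈ (c - dWord b).support, suffixOff X w ∈ E := by
  have main : ∀ j : ℕ, ∃ K' : ℝ, 0 ≤ K' ∧
      ∀ (V : Type u) (F : Set (List V)) (X : Set V) (E : Set (List V)), SublistClosed F →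
        [] ∈ E → (∀ e ∈ E, e.length ≤ 1) →
        (∀ x v, x ∉ X → x :: v ∈ F → x :: v ∉ E → v.length + 1 ≤ p →
          Fillable (linkIn F X (x :: v)) (p - (v.length + 1)) K) →
        ∀ c ∈ chainsOn F p, dWord c = 0 →
          (∀ w ∈ c.support, (suffixOff X w).length ≤ j ∨ suffixOff X w ∈ E) →
          ∃ b ∈ chainsOn F (p + 1), l1 b ≤ K' * l1 c ∧
            ∀ w ∈ (c - dWord b).support, suffixOff X w ∈ E := by
    intro j
    induction j with
    | zero =>
      refine ⟨0, le_rfl, fun V F X E _ h0 _ _ c _ _ hs => ⟨0, Submodule.zero_mem _, by simp, ?_⟩⟩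
      intro w hw
      rw [map_zero, sub_zero] at hw
      rcases hs w hw with h | h
      · rw [List.length_eq_zero_iff.1 (Nat.le_zero.1 h)]; exact h0
      · exact h
    | succ j ih =>
      obtain ⟨K', hK', ih⟩ := ih
      -- shortening the suffixes replaces `c` by `c - ∂b`, whose norm is at most `1 + (p + 1) * K`
      -- times that of `c`, as the boundary of a word of length `p + 1` has norm at most `p + 1`
      refine ⟨K + K' * (1 + (p + 1) * K), by positivity, ?_⟩
      intro V F X E hF h0 hE hfill c hc hd hs
      obtain ⟨b, hb, hbn, hbs⟩ := exists_shorten_suffix hF hK hfill hc hd (j := j) (by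
        intro w hw
        rcases hs w hw with h | h
        · exact h
        · exact (hE _ h).trans (by omega))
      obtain ⟨b', hb', hbn', hbs'⟩ := ih V F X E hF h0 hE hfill (c - dWord b)
        (Submodule.sub_mem _ hc (dWord_mem_chainsOn hF hb))
        (by rw [map_sub, hd, dWord_dWord, sub_zero]) hbs
      refine ⟨b + b', Submodule.add_mem _ hb hb', ?_, ?_⟩
      · have h1 := l1_add_le b b'
        have h2 := l1_sub_le c (dWord b)
        have h3 := l1_dWord_le hb
        have h4 : l1 (c - dWord b) ≤ (1 + (p + 1) * K) * l1 c := by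
          push_cast at h3
          have : ((p : ℝ) + 1) * l1 b ≤ (p + 1) * (K * l1 c) := by gcongr
          linarith
        have h5 := mul_le_mul_of_nonneg_left h4 hK'
        linarith
      · rw [map_add, ← sub_sub]
        exact hbs'
  obtain ⟨K', hK', h⟩ := main p
  refine ⟨K', hK', fun V F X E hF h0 hE hfill c hc hd => h V F X E hF h0 hE hfill c hc hd ?_⟩
  intro w hw
  left
  refine (length_suffixOff_le w).trans ?_
  rw [(hc hw).2]

/-- If the words of `F` with letters in `X` and the links in `X` of all words that start outside
`X` can be filled, in complementary degrees, then `F` can be filled. -/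
lemma fillable_of_links (p : ℕ) (K : ℝ) (hK : 0 ≤ K) : ∃ K' : ℝ, 0 ≤ K' ∧
    ∀ (V : Type u) (F : Set (List V)) (X : Set V), SublistClosed F →
      Fillable (linkIn F X []) p K →
      (∀ x v, x ∉ X → x :: v ∈ F → v.length + 1 ≤ p →
        Fillable (linkIn F X (x :: v)) (p - (v.length + 1)) K) →
      Fillable F p K' := by
  obtain ⟨K', hK', h⟩ := exists_suffix_mem.{u} p K hK
  refine ⟨K' + K * (1 + (p + 1) * K'), by positivity, ?_⟩
  intro V F X hF hX hfill c hc hd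
  obtain ⟨b, hb, hbn, hbs⟩ := h V F X {[]} hF rfl (by simp) (fun x v hx hv _ hl =>
    hfill x v hx hv hl) c hc hd
  have hc' : c - dWord b ∈ chainsOn F p := Submodule.sub_mem _ hc (dWord_mem_chainsOn hF hb)
  obtain ⟨b', hb', hbd', hbn'⟩ := hX (c - dWord b)
    (fun w hw => ⟨⟨eq_nil_of_suffixOff (hbs w hw), by simpa using (hc' hw).1⟩, (hc' hw).2⟩)
    (by rw [map_sub, hd, dWord_dWord, sub_zero])
  refine ⟨b + b', Submodule.add_mem _ hb (fun w hw => ⟨by simpa using (hb' hw).1.2, (hb' hw).2⟩),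
    by rw [map_add, hbd']; abel, ?_⟩
  have h1 := l1_add_le b b'
  have h2 := l1_sub_le c (dWord b)
  have h3 := l1_dWord_le hb
  have h4 : l1 (c - dWord b) ≤ (1 + (p + 1) * K') * l1 c := by
    push_cast at h3
    have : ((p : ℝ) + 1) * l1 b ≤ (p + 1) * (K' * l1 c) := by gcongr
    linarith
  have h5 := mul_le_mul_of_nonneg_left h4 hK
  linarith

open Classical in
/-- The cone operator, which appends the letter `y` to the words with letters in `X`, with the
sign that makes it a contraction. -/
def coneMap {V : Type u} (X : Set V) (y : V) : (List V →₀ ℝ) →ₗ[ℝ] (List V →₀ ℝ) :=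
  Finsupp.linearCombination ℝ fun w =>
    if suffixOff X w = [] then (-1 : ℝ) ^ w.length • Finsupp.single (w ++ [y]) 1 else 0

open Classical in
lemma coneMap_single {V : Type u} (X : Set V) (y : V) (w : List V) :
    coneMap X y (Finsupp.single w 1) =
      if suffixOff X w = [] then (-1 : ℝ) ^ w.length • Finsupp.single (w ++ [y]) 1 else 0 := by
  simp [coneMap]

/-- The cone operator contracts the complex of the words `u` and `(u, y)`, where `u` has letters
in `X`. -/
lemma dWord_coneMap {V : Type u} {X : Set V} {y : V} (hy : y ∉ X) {c : List V →₀ ℝ}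
    (hc : ∀ w ∈ c.support, suffixOff X w = [] ∨ suffixOff X w = [y]) :
    dWord (coneMap X y c) + coneMap X y (dWord c) = c := by
  classical
  change (dWord ∘ₗ coneMap X y + coneMap X y ∘ₗ dWord) c =
    (LinearMap.id : (List V →₀ ℝ) →ₗ[ℝ] _) c
  refine map_eq_of_supported (S := {w | suffixOff X w = [] ∨ suffixOff X w = [y]}) _ _ ?_ hc
  intro w hw
  have hcX : ∀ u : List V, (∀ x ∈ u, x ∈ X) → suffixOff X u = [] := fun u hu => by
    simpa [suffixOff] using hu
  have hcy : ∀ u : List V, (∀ x ∈ u, x ∈ X) → suffixOff X (u ++ [y]) ≠ [] := fun u hu => by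
    rw [suffixOff_append hu, suffixOff_cons_of_notMem hy]
    simp
  have hsign : ∀ n : ℕ, (-1 : ℝ) ^ n * (-1) ^ n = 1 := fun n => by rw [← mul_pow]; simp
  -- the cone operator on the boundary of a word with letters in `X`
  have hbd : ∀ u : List V, (∀ x ∈ u, x ∈ X) → coneMap X y (wordBoundary u) =
      (-(-1 : ℝ) ^ u.length • appendMap [y]) (wordBoundary u) := by
    intro u hu
    refine map_eq_of_supported _ _ (fun u' hu' => ?_) (wordBoundary_mem u)
    rw [coneMap_single, if_pos (hcX u' fun x hx => hu x (hu'.1.subset hx)), ← hu'.2, pow_succ]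
    simp
  have hy1 : wordBoundary [y] = Finsupp.single [] 1 := by simp [wordBoundary]
  simp only [LinearMap.add_apply, LinearMap.comp_apply, dWord_single, one_smul, LinearMap.id_apply]
  rcases hw with h | h
  · have hu := eq_nil_of_suffixOff h
    rw [coneMap_single, if_pos h, map_smul, dWord_single, one_smul, wordBoundary_append, hbd w hu,
      smul_add, smul_smul, hsign, hy1]
    simp
  · obtain ⟨u, hu, rfl⟩ : ∃ u : List V, (∀ x ∈ u, x ∈ X) ∧ u ++ [y] = w :=
      ⟨prefixIn X w, fun x hx => mem_of_mem_prefixIn hx, by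
        rw [← h]; exact prefixIn_append_suffixOff w⟩
    have hz : coneMap X y (appendMap [y] (wordBoundary u)) = 0 := by
      refine map_eq_zero_of_supported (coneMap X y ∘ₗ appendMap [y])
        (fun u' hu' => ?_) (wordBoundary_mem u)
      rw [LinearMap.comp_apply, appendMap_single, coneMap_single,
        if_neg (hcy u' fun x hx => hu x (hu'.1.subset hx))]
    rw [coneMap_single, if_neg (hcy u hu), map_zero, zero_add, wordBoundary_append, map_add, hz,
      zero_add, hy1, map_smul, prependMap_single, List.append_nil, coneMap_single,
      if_pos (hcX u hu), smul_smul, hsign, one_smul]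

/-- If the letter `y` outside `X` can be appended to all words of `F` with letters in `X`, then
these words and the words ending in `y` form a cone. Hence `F` can be filled if the links in `X`
of all words that start outside `X`, except that of `y` itself, can be filled in complementary
degrees. -/
lemma fillable_of_cone (p : ℕ) (K : ℝ) (hK : 0 ≤ K) : ∃ K' : ℝ, 0 ≤ K' ∧
    ∀ (V : Type u) (F : Set (List V)) (X : Set V) (y : V), SublistClosed F → y ∉ X →
      (∀ w ∈ F, (∀ x ∈ w, x ∈ X) → w ++ [y] ∈ F) →
      (∀ x v, x ∉ X → x :: v ∈ F → v.length + 1 ≤ p →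
        Fillable (linkIn F X (x :: v)) (p - (v.length + 1)) K) →
      Fillable F p K' := by
  obtain ⟨K', hK', h⟩ := exists_suffix_mem.{u} p K hK
  refine ⟨K' + 1 * (1 + (p + 1) * K'), by positivity, ?_⟩
  intro V F X y hF hy hcone hfill c hc hd
  obtain ⟨b, hb, hbn, hbs⟩ := h V F X {[], [y]} hF (by simp) (by simp) (fun x v hx hv _ hl =>
    hfill x v hx hv hl) c hc hd
  have hc' : c - dWord b ∈ chainsOn F p := Submodule.sub_mem _ hc (dWord_mem_chainsOn hF hb)
  have hd' : dWord (c - dWord b) = 0 := by rw [map_sub, hd, dWord_dWord, sub_zero]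
  have h2 := l1_sub_le c (dWord b)
  have h3 := l1_dWord_le hb
  have h4 : l1 (c - dWord b) ≤ (1 + (p + 1) * K') * l1 c := by
    push_cast at h3
    have : ((p : ℝ) + 1) * l1 b ≤ (p + 1) * (K' * l1 c) := by gcongr
    linarith
  set c' := c - dWord b
  have hcomp : c' = dWord (coneMap X y c') := by
    have := dWord_coneMap hy (c := c') fun w hw => by simpa using hbs w hw
    rwa [hd', map_zero, add_zero, eq_comm] at this
  have hb' : coneMap X y c' ∈ chainsOn F (p + 1) := by
    refine map_mem_of_supported _ (fun w hw => ?_) hc'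
    rw [coneMap_single]
    split_ifs with h
    · refine Submodule.smul_mem _ _ ?_
      apply single_mem_supported
      exact ⟨hcone w hw.1 (eq_nil_of_suffixOff h), by simp [hw.2]⟩
    · exact Submodule.zero_mem _
  have hn : l1 (coneMap X y c') ≤ 1 * l1 c' := l1_map_le _ fun w _ => by
    rw [coneMap_single]
    split_ifs <;> simp
  refine ⟨b + coneMap X y c', Submodule.add_mem _ hb hb', ?_, ?_⟩
  · rw [map_add, ← hcomp]
    exact add_sub_cancel _ _
  · have h1 := l1_add_le b (coneMap X y c')
    linarith

end Reduction

/-! ### From words to flags of words -/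

section Flags

variable {V : Type u}

/-- The flags of non-empty words in `F`, listed from the largest to the smallest word. -/
def flagsOf (F : Set (List V)) : Set (List (List V)) :=
  {f | f.Pairwise (fun x y => y.Sublist x ∧ y ≠ x) ∧ ∀ x ∈ f, x ∈ F ∧ x ≠ []}

/-- The flags of non-empty subsequences of `w`, possibly including `w` itself. -/
abbrev flagsBelow (w : List V) : Set (List (List V)) := flagsOf {x | x.Sublist w}

lemma sublistClosed_flagsOf (F : Set (List V)) : SublistClosed (flagsOf F) :=
  fun _ hf _ h => ⟨hf.1.sublist h, fun x hx => hf.2 x (h.subset hx)⟩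

lemma flagsOf_mono {F F' : Set (List V)} (h : F ⊆ F') : flagsOf F ⊆ flagsOf F' :=
  fun _ hf => ⟨hf.1, fun x hx => ⟨h (hf.2 x hx).1, (hf.2 x hx).2⟩⟩

lemma chainsOn_mono {W : Type*} {F F' : Set (List W)} (h : F ⊆ F') (p : ℕ) :
    chainsOn F p ≤ chainsOn F' p :=
  Finsupp.supported_mono fun _ hf => ⟨h hf.1, hf.2⟩

/-- Barycentric subdivision of chains of words of length `n`: the cone, with apex the word itself,
over the subdivision of the boundary. -/
def subdivision : ℕ → (List V →₀ ℝ) →ₗ[ℝ] (List (List V) →₀ ℝ)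
  | 0 => Finsupp.linearCombination ℝ fun _ => Finsupp.single [] 1
  | n + 1 => Finsupp.linearCombination ℝ fun w => consMap w (subdivision n (wordBoundary w))

lemma subdivision_succ_single (n : ℕ) (w : List V) :
    subdivision (n + 1) (Finsupp.single w 1) = consMap w (subdivision n (wordBoundary w)) := by
  simp [subdivision]

lemma wordBoundary_mem_chainsOn {W : Type*} {n : ℕ} {w : List W} (h : w.length = n + 1) :
    wordBoundary w ∈ chainsOn {w' | w'.Sublist w} n := by
  refine Finsupp.supported_mono ?_ (wordBoundary_mem w)
  intro w' hw'
  exact ⟨hw'.1, by have := hw'.2; omega⟩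

lemma subdivision_mem {n : ℕ} {w : List V} (h : w.length = n) :
    subdivision n (Finsupp.single w 1) ∈ chainsOn (flagsBelow w) n := by
  induction n generalizing w with
  | zero =>
    simp only [subdivision, Finsupp.linearCombination_single, one_smul]
    apply single_mem_supported
    exact ⟨⟨List.Pairwise.nil, by simp⟩, rfl⟩
  | succ n ih =>
    rw [subdivision_succ_single]
    refine map_mem_of_supported (consMap w ∘ₗ subdivision n) (fun w' hw' => ?_)
      (wordBoundary_mem_chainsOn h)
    refine map_mem_of_supported (consMap w) (fun f hf => ?_) (ih hw'.2)
    rw [consMap_single]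
    apply single_mem_supported
    have hlt : w'.length < w.length := by rw [hw'.2, h]; omega
    refine ⟨⟨List.pairwise_cons.2 ⟨fun y hy => ?_, hf.1.1⟩, fun x hx => ?_⟩, by simp [hf.2]⟩
    · have hy' := (hf.1.2 y hy).1
      refine ⟨List.Sublist.trans hy' hw'.1, ?_⟩
      rintro rfl
      exact absurd (List.Sublist.length_le hy') (by omega)
    · rcases List.mem_cons.1 hx with rfl | hx
      · exact ⟨List.Sublist.refl _, by rintro rfl; simp at h⟩
      · exact ⟨List.Sublist.trans (hf.1.2 x hx).1 hw'.1, (hf.1.2 x hx).2⟩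

lemma l1_subdivision_le {n : ℕ} {w : List V} (h : w.length = n) :
    l1 (subdivision n (Finsupp.single w 1)) ≤ n.factorial := by
  induction n generalizing w with
  | zero => simp [subdivision]
  | succ n ih =>
    rw [subdivision_succ_single]
    have h1 : l1 (consMap w (subdivision n (wordBoundary w))) ≤ n.factorial * l1 (wordBoundary w) :=
      l1_map_le (consMap w ∘ₗ subdivision n) fun w' hw' =>
        (l1_map_le (C := 1) (consMap w) fun f _ => by simp).trans
          (by rw [one_mul]; exact ih (wordBoundary_mem_chainsOn h hw').2)
    refine h1.trans ?_
    have h2 := l1_wordBoundary_le w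
    rw [h] at h2
    rw [Nat.factorial_succ, Nat.cast_mul, mul_comm]
    gcongr

lemma dWord_subdivision (n : ℕ) {w : List V} (h : w.length = n + 1) :
    dWord (subdivision (n + 1) (Finsupp.single w 1)) = subdivision n (wordBoundary w) := by
  induction n generalizing w with
  | zero =>
    rw [subdivision_succ_single, dWord_consMap, sub_eq_self]
    refine map_eq_zero_of_supported (consMap w ∘ₗ dWord ∘ₗ subdivision 0) (fun w' _ => ?_)
      (wordBoundary_mem_chainsOn h)
    simp [subdivision, wordBoundary]
  | succ n ih =>
    rw [subdivision_succ_single, dWord_consMap, sub_eq_self]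
    have h1 : (dWord ∘ₗ subdivision (n + 1)) (wordBoundary w) =
        (subdivision n ∘ₗ dWord) (wordBoundary w) := by
      refine map_eq_of_supported _ _ (fun w' hw' => ?_) (wordBoundary_mem_chainsOn h)
      simp only [LinearMap.comp_apply, dWord_single, one_smul]
      exact ih hw'.2
    rw [LinearMap.comp_apply, LinearMap.comp_apply, dWord_wordBoundary, map_zero] at h1
    rw [h1, map_zero]

open Classical in
/-- The cone operator with apex the largest word `x` of a flag; flags that contain `x` already are
degenerate and sent to `0`. -/
def coneTop (x : List V) : (List (List V) →₀ ℝ) →ₗ[ℝ] (List (List V) →₀ ℝ) :=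
  Finsupp.linearCombination ℝ fun f => if f.head? = some x then 0 else Finsupp.single (x :: f) 1

open Classical in
lemma coneTop_single (x : List V) (f : List (List V)) : coneTop x (Finsupp.single f 1) =
    if f.head? = some x then 0 else Finsupp.single (x :: f) 1 := by
  simp [coneTop]

lemma notMem_of_head_ne {x : List V} {f : List (List V)} (hf : f ∈ flagsBelow x)
    (h : f.head? ≠ some x) : x ∉ f := by
  intro hx
  cases f with
  | nil => simp at hx
  | cons y g =>
    rcases List.mem_cons.1 hx with rfl | hxg
    · simp at h
    · have h1 := (List.pairwise_cons.1 hf.1).1 x hxg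
      exact h1.2 (h1.1.antisymm (hf.2 y (by simp)).1)

lemma coneTop_mem {x : List V} (hx : x ≠ []) {n : ℕ} {c : List (List V) →₀ ℝ}
    (hc : c ∈ chainsOn (flagsBelow x) n) : coneTop x c ∈ chainsOn (flagsBelow x) (n + 1) := by
  classical
  refine map_mem_of_supported _ (fun f hf => ?_) hc
  rw [coneTop_single]
  split_ifs with h
  · exact Submodule.zero_mem _
  · apply single_mem_supported
    refine ⟨⟨List.pairwise_cons.2 ⟨fun y hy => ⟨(hf.1.2 y hy).1, ?_⟩, hf.1.1⟩, fun y hy => ?_⟩,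
      by simp [hf.2]⟩
    · rintro rfl
      exact notMem_of_head_ne hf.1 h hy
    · rcases List.mem_cons.1 hy with rfl | hy
      · exact ⟨List.Sublist.refl _, hx⟩
      · exact hf.1.2 y hy

lemma dWord_coneTop {x : List V} {n : ℕ} {c : List (List V) →₀ ℝ}
    (hc : c ∈ chainsOn (flagsBelow x) n) : dWord (coneTop x c) = c - coneTop x (dWord c) := by
  classical
  change (dWord ∘ₗ coneTop x) c = (LinearMap.id - coneTop x ∘ₗ dWord :
    (List (List V) →₀ ℝ) →ₗ[ℝ] _) c
  refine map_eq_of_supported _ _ (fun f hf => ?_) hc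
  simp only [LinearMap.comp_apply, LinearMap.sub_apply, LinearMap.id_apply, dWord_single, one_smul]
  by_cases h : f.head? = some x
  · obtain ⟨g, rfl⟩ : ∃ g, f = x :: g := by
      cases f with
      | nil => simp at h
      | cons y g => exact ⟨g, by simpa using h⟩
    have hg : g.head? ≠ some x := by
      intro hg
      exact ((List.pairwise_cons.1 hf.1.1).1 x (List.mem_of_mem_head? hg)).2 rfl
    have hz : coneTop x (consMap x (wordBoundary g)) = 0 := by
      refine map_eq_zero_of_supported (coneTop x ∘ₗ consMap x) (fun g' _ => ?_) (wordBoundary_mem g)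
      rw [LinearMap.comp_apply, consMap_single, coneTop_single, if_pos (by simp)]
    rw [coneTop_single, if_pos h, wordBoundary, map_sub, hz, coneTop_single, if_neg hg]
    simp
  · have hxf := notMem_of_head_ne hf.1 h
    have hz : coneTop x (wordBoundary f) = consMap x (wordBoundary f) := by
      refine map_eq_of_supported _ _ (fun f' hf' => ?_) (wordBoundary_mem f)
      rw [consMap_single, coneTop_single, if_neg]
      intro h'
      exact hxf (hf'.1.subset (List.mem_of_mem_head? h'))
    rw [coneTop_single, if_neg h, dWord_single, one_smul, wordBoundary, hz]

lemma headI_mem [Inhabited V] {x : List V} (hx : x ≠ []) : x.headI ∈ x := by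
  cases x with
  | nil => exact absurd rfl hx
  | cons a t => simp

lemma single_mem_flagsBelow {F : Set (List V)} {n : ℕ} {f : List (List V)}
    (hf : f ∈ flagsOf F) (hn : f.length = n) :
    (Finsupp.single f 1 : List (List V) →₀ ℝ) ∈ chainsOn (flagsBelow f.headI) n := by
  apply single_mem_supported
  refine ⟨⟨hf.1, fun x hx => ⟨?_, (hf.2 x hx).2⟩⟩, hn⟩
  cases f with
  | nil => simp at hx
  | cons a g =>
    rcases List.mem_cons.1 hx with rfl | hx
    · exact List.Sublist.refl _
    · exact ((List.pairwise_cons.1 hf.1).1 x hx).1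

lemma headI_sublist_headI {F : Set (List V)} {f f' : List (List V)} (hf : f ∈ flagsOf F)
    (h : f'.Sublist f) (hne : f' ≠ []) : f'.headI.Sublist f.headI := by
  have h1 := headI_mem hne
  have h2 := single_mem_flagsBelow hf rfl
    (show f ∈ ((Finsupp.single f 1 : List (List V) →₀ ℝ).support : Set _) by simp)
  exact (h2.1.2 _ (h.subset h1)).1

section Heads

variable [Inhabited V]

open Classical in
/-- The map from flags to words that replaces every word of a flag by its first letter. Words with
repeated letters, which come from degenerate simplices, are sent to `0`. -/
def headsMap : (List (List V) →₀ ℝ) →ₗ[ℝ] (List V →₀ ℝ) :=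
  Finsupp.linearCombination ℝ fun f =>
    if (f.map List.headI).Nodup then Finsupp.single (f.map List.headI) 1 else 0

open Classical in
lemma headsMap_single (f : List (List V)) : headsMap (Finsupp.single f 1) =
    if (f.map List.headI).Nodup then Finsupp.single (f.map List.headI) 1 else 0 := by
  simp [headsMap]

lemma l1_headsMap_le (c : List (List V) →₀ ℝ) : l1 (headsMap c) ≤ 1 * l1 c := by
  classical
  refine l1_map_le _ fun f _ => ?_
  rw [headsMap_single]
  split_ifs <;> simp

lemma sublist_tail_of_headI_ne {x y : List V} (h : y.Sublist x) (hy : y ≠ [])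
    (hne : y.headI ≠ x.headI) : y.Sublist x.tail := by
  cases x with
  | nil => exact absurd (List.sublist_nil.1 h) hy
  | cons a t =>
    rcases List.sublist_cons_iff.1 h with h | ⟨r, rfl, _⟩
    · exact h
    · simp at hne

lemma heads_sublist {F : Set (List V)} {f : List (List V)} (hf : f ∈ flagsOf F)
    (hn : (f.map List.headI).Nodup) : (f.map List.headI).Sublist f.headI := by
  induction f with
  | nil => exact List.Sublist.refl _
  | cons a g ih =>
    have hane : a ≠ [] := (hf.2 a (by simp)).2
    obtain ⟨h, t, rfl⟩ := List.exists_cons_of_ne_nil hane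
    cases g with
    | nil => simp
    | cons b g =>
      have hb := (List.pairwise_cons.1 hf.1).1 b (by simp)
      have h1 := ih ⟨(List.pairwise_cons.1 hf.1).2, fun x hx => hf.2 x (by simp [hx])⟩
        (List.Nodup.of_cons hn)
      have h2 : b.Sublist t := by
        refine sublist_tail_of_headI_ne hb.1 (hf.2 b (by simp)).2 fun h => ?_
        simp only [List.map_cons, List.nodup_cons, List.mem_cons] at hn
        exact hn.1 (Or.inl h.symm)
      exact (h1.trans h2).cons_cons h

/-- Equal first letters in a flag of words without repetition are adjacent. -/
lemma heads_adjacent {F : Set (List V)} (hF : ∀ w ∈ F, w.Nodup) {f : List (List V)}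
    (hf : f ∈ flagsOf F) (hn : ¬ (f.map List.headI).Nodup) :
    ∃ u x v, f.map List.headI = u ++ x :: x :: v := by
  induction f with
  | nil => simp at hn
  | cons a g ih =>
    by_cases hg : (g.map List.headI).Nodup
    · cases g with
      | nil => simp at hn
      | cons b g =>
        by_cases hab : b.headI = a.headI
        · exact ⟨[], a.headI, g.map List.headI, by simp [hab]⟩
        exfalso
        have hb := (List.pairwise_cons.1 hf.1).1 b (by simp)
        have h2 : b.Sublist a.tail := sublist_tail_of_headI_ne hb.1 (hf.2 b (by simp)).2 hab
        have h3 : a.headI ∈ (b :: g).map List.headI := by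
          by_contra h
          exact hn (List.nodup_cons.2 ⟨h, hg⟩)
        obtain ⟨z, hz, hza⟩ := List.mem_map.1 h3
        have hzb : z.Sublist b := by
          rcases List.mem_cons.1 hz with rfl | hz
          · exact List.Sublist.refl _
          · exact ((List.pairwise_cons.1 (List.pairwise_cons.1 hf.1).2).1 z hz).1
        have h4 : a.headI ∈ a.tail := by
          rw [← hza]
          exact h2.subset (hzb.subset (headI_mem (hf.2 z (by simp [hz])).2))
        have hand := hF a (hf.2 a (by simp)).1
        obtain ⟨h, t, rfl⟩ := List.exists_cons_of_ne_nil (hf.2 a (by simp)).2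
        exact (List.nodup_cons.1 hand).1 h4
    · obtain ⟨u, x, v, h⟩ :=
        ih ⟨(List.pairwise_cons.1 hf.1).2, fun x hx => hf.2 x (by simp [hx])⟩ hg
      exact ⟨a.headI :: u, x, v, by simp [h]⟩

lemma wordBoundary_map {W W' : Type*} (φ : W → W') (w : List W) :
    Finsupp.lmapDomain ℝ ℝ (List.map φ) (wordBoundary w) = wordBoundary (w.map φ) := by
  induction w with
  | nil => simp [wordBoundary]
  | cons x w ih =>
    have : ∀ c : List W →₀ ℝ, Finsupp.lmapDomain ℝ ℝ (List.map φ) (consMap x c) =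
        consMap (φ x) (Finsupp.lmapDomain ℝ ℝ (List.map φ) c) := by
      intro c
      simp [consMap, ← Finsupp.mapDomain_comp, Function.comp_def]
    simp only [wordBoundary, map_sub, this, ih, List.map_cons]
    simp

lemma headsMap_wordBoundary {F : Set (List V)} (hF : ∀ w ∈ F, w.Nodup) {f : List (List V)}
    (hf : f ∈ flagsOf F) : headsMap (wordBoundary f) = dWord (headsMap (Finsupp.single f 1)) := by
  classical
  set N : (List V →₀ ℝ) →ₗ[ℝ] (List V →₀ ℝ) :=
    Finsupp.linearCombination ℝ fun w => if w.Nodup then Finsupp.single w 1 else 0 with hN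
  have hN1 : ∀ w : List V, N (Finsupp.single w 1) = if w.Nodup then Finsupp.single w 1 else 0 := by
    simp [hN]
  have hcomp : headsMap (wordBoundary f) = N (wordBoundary (f.map List.headI)) := by
    rw [← wordBoundary_map]
    refine map_eq_of_supported headsMap (N ∘ₗ Finsupp.lmapDomain ℝ ℝ (List.map List.headI))
      (fun g _ => ?_) (wordBoundary_mem f)
    rw [headsMap_single, LinearMap.comp_apply, Finsupp.lmapDomain_apply, Finsupp.mapDomain_single,
      hN1]
  rw [hcomp, headsMap_single]
  split_ifs with hn
  · rw [dWord_single, one_smul]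
    change N _ = (LinearMap.id : (List V →₀ ℝ) →ₗ[ℝ] _) _
    refine map_eq_of_supported _ _ (fun w hw => ?_) (wordBoundary_mem (f.map List.headI))
    rw [hN1, if_pos (hn.sublist hw.1), LinearMap.id_apply]
  · rw [map_zero]
    obtain ⟨u, x, v, h⟩ := heads_adjacent hF hf hn
    -- the two faces that omit one of the equal letters cancel
    have hxx : wordBoundary (x :: x :: v) = consMap x (consMap x (wordBoundary v)) := by
      simp [wordBoundary]
    rw [h, wordBoundary_append, hxx, map_add, map_smul]
    have h1 : N (appendMap (x :: x :: v) (wordBoundary u)) = 0 := by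
      refine map_eq_zero_of_supported (N ∘ₗ appendMap (x :: x :: v)) (fun w _ => ?_)
        (wordBoundary_mem u)
      rw [LinearMap.comp_apply, appendMap_single, hN1, if_neg]
      simp [List.nodup_append]
    have h2 : N (prependMap u (consMap x (consMap x (wordBoundary v)))) = 0 := by
      refine map_eq_zero_of_supported (N ∘ₗ prependMap u ∘ₗ consMap x ∘ₗ consMap x) (fun w _ => ?_)
        (wordBoundary_mem v)
      simp only [LinearMap.comp_apply, consMap_single, prependMap_single]
      rw [hN1, if_neg]
      simp [List.nodup_append]
    rw [h1, h2, smul_zero, add_zero]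

lemma headsMap_mem {F : Set (List V)} (hF : SublistClosed F) {n : ℕ} {c : List (List V) →₀ ℝ}
    (h0 : [] ∈ F) (hc : c ∈ chainsOn (flagsOf F) n) : headsMap c ∈ chainsOn F n := by
  classical
  refine map_mem_of_supported _ (fun f hf => ?_) hc
  rw [headsMap_single]
  split_ifs with h
  · apply single_mem_supported
    refine ⟨?_, by simpa using hf.2⟩
    cases f with
    | nil => exact h0
    | cons a g => exact hF a (hf.1.2 a (by simp)).1 _ (heads_sublist hf.1 h)
  · exact Submodule.zero_mem _

/-- The chain homotopy between the identity and the subdivision of the words of first letters. It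
is constructed with the flags below the largest word of a flag as an acyclic carrier. -/
def flagHomotopy : ℕ → (List (List V) →₀ ℝ) →ₗ[ℝ] (List (List V) →₀ ℝ)
  | 0 => 0
  | n + 1 => Finsupp.linearCombination ℝ fun f => coneTop f.headI
      (Finsupp.single f 1 - subdivision (n + 1) (headsMap (Finsupp.single f 1)) -
        flagHomotopy n (wordBoundary f))

lemma flagHomotopy_succ_single (n : ℕ) (f : List (List V)) :
    flagHomotopy (n + 1) (Finsupp.single f 1) = coneTop f.headI
      (Finsupp.single f 1 - subdivision (n + 1) (headsMap (Finsupp.single f 1)) -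
        flagHomotopy n (wordBoundary f)) := by
  simp [flagHomotopy]

lemma subdivision_headsMap_mem {F : Set (List V)} {n : ℕ} {f : List (List V)}
    (hf : f ∈ flagsOf F) (hn : f.length = n) :
    subdivision n (headsMap (Finsupp.single f 1)) ∈ chainsOn (flagsBelow f.headI) n := by
  classical
  rw [headsMap_single]
  split_ifs with h
  · refine chainsOn_mono (flagsOf_mono ?_) _ (subdivision_mem (by simpa using hn))
    exact fun w hw => List.Sublist.trans hw (heads_sublist hf h)
  · rw [map_zero]
    exact Submodule.zero_mem _

/-- The homotopy respects the acyclic carrier, and so does the chain whose cone it is in positive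
degrees. -/
lemma flagHomotopy_mem {F : Set (List V)} {n : ℕ} {f : List (List V)}
    (hf : f ∈ flagsOf F) (hn : f.length = n) :
    flagHomotopy n (Finsupp.single f 1) ∈ chainsOn (flagsBelow f.headI) (n + 1) ∧
    (∀ m, n = m + 1 → Finsupp.single f 1 - subdivision n (headsMap (Finsupp.single f 1)) -
        flagHomotopy m (wordBoundary f) ∈ chainsOn (flagsBelow f.headI) n) := by
  induction n generalizing f with
  | zero => exact ⟨Submodule.zero_mem _, fun m h => by omega⟩
  | succ n ih =>
    have key : Finsupp.single f 1 - subdivision (n + 1) (headsMap (Finsupp.single f 1)) -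
        flagHomotopy n (wordBoundary f) ∈ chainsOn (flagsBelow f.headI) (n + 1) := by
      refine Submodule.sub_mem _ (Submodule.sub_mem _ (single_mem_flagsBelow hf hn)
        (subdivision_headsMap_mem hf hn)) ?_
      refine map_mem_of_supported _ (fun f' hf' => ?_) (wordBoundary_mem_chainsOn hn)
      cases n with
      | zero => exact Submodule.zero_mem _
      | succ n =>
        refine chainsOn_mono (flagsOf_mono fun w hw => ?_) _
          (ih (sublistClosed_flagsOf F f hf f' hf'.1) hf'.2).1
        refine List.Sublist.trans hw (headI_sublist_headI hf hf'.1 ?_)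
        rintro rfl
        simpa using hf'.2
    refine ⟨?_, fun m hm => ?_⟩
    · rw [flagHomotopy_succ_single]
      refine coneTop_mem (hf.2 _ (headI_mem ?_)).2 key
      rintro rfl
      simp at hn
    · obtain rfl : n = m := by omega
      exact key

lemma dWord_flagHomotopy {F : Set (List V)} (hF : ∀ w ∈ F, w.Nodup) {n : ℕ}
    {c : List (List V) →₀ ℝ} (hc : c ∈ chainsOn (flagsOf F) n) (hd : dWord c = 0) :
    dWord (flagHomotopy n c) = c - subdivision n (headsMap c) := by
  induction n generalizing c with
  | zero =>
    rw [flagHomotopy, LinearMap.zero_apply, map_zero, eq_comm, sub_eq_zero]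
    change (LinearMap.id : (List (List V) →₀ ℝ) →ₗ[ℝ] _) c = (subdivision 0 ∘ₗ headsMap) c
    refine map_eq_of_supported _ _ (fun f hf => ?_) hc
    obtain rfl := List.length_eq_zero_iff.1 hf.2
    simp [headsMap_single, subdivision]
  | succ n ih =>
    have h1 : (dWord ∘ₗ flagHomotopy (n + 1)) c =
        (LinearMap.id - subdivision (n + 1) ∘ₗ headsMap - flagHomotopy n ∘ₗ dWord :
          (List (List V) →₀ ℝ) →ₗ[ℝ] _) c := by
      refine map_eq_of_supported _ _ (fun f hf => ?_) hc
      have hmem := (flagHomotopy_mem hf.1 hf.2).2 n rfl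
      have hbd : wordBoundary f ∈ chainsOn (flagsOf F) n :=
        chainsOn_mono (fun f' hf' => sublistClosed_flagsOf F f hf.1 f' hf') _
          (wordBoundary_mem_chainsOn hf.2)
      have hlen : ∀ c' ∈ chainsOn {w : List V | True} (n + 1), dWord (subdivision (n + 1) c') =
          subdivision n (dWord c') := by
        intro c' hc'
        refine map_eq_of_supported (dWord ∘ₗ subdivision (n + 1)) (subdivision n ∘ₗ dWord)
          (fun w hw => ?_) hc'
        simp only [LinearMap.comp_apply, dWord_single, one_smul]
        exact dWord_subdivision n hw.2
      have hz : dWord (Finsupp.single f 1 - subdivision (n + 1) (headsMap (Finsupp.single f 1)) -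
          flagHomotopy n (wordBoundary f)) = 0 := by
        rw [map_sub, map_sub, ih hbd (dWord_wordBoundary f), hlen, ← headsMap_wordBoundary hF hf.1,
          dWord_single, one_smul, sub_self]
        classical
        rw [headsMap_single]
        split_ifs
        · apply single_mem_supported
          exact ⟨trivial, by simpa using hf.2⟩
        · exact Submodule.zero_mem _
      simp only [LinearMap.comp_apply, LinearMap.sub_apply, LinearMap.id_apply, dWord_single,
        one_smul]
      rw [flagHomotopy_succ_single, dWord_coneTop hmem, hz, map_zero, sub_zero]
    simpa [hd] using h1

lemma exists_l1_flagHomotopy_le (n : ℕ) : ∃ H : ℝ, 0 ≤ H ∧ ∀ (V : Type u) [Inhabited V]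
    (f : List (List V)), f.length = n → l1 (flagHomotopy n (Finsupp.single f 1)) ≤ H := by
  classical
  induction n with
  | zero => exact ⟨0, le_rfl, fun V _ f _ => by simp [flagHomotopy]⟩
  | succ n ih =>
    obtain ⟨H, hH, ih⟩ := ih
    refine ⟨1 + (n + 1).factorial + H * (n + 1), by positivity, fun V _ f hf => ?_⟩
    rw [flagHomotopy_succ_single]
    have h0 : ∀ c, l1 (coneTop f.headI c) ≤ 1 * l1 c := fun c => l1_map_le _ fun g _ => by
      rw [coneTop_single]
      split_ifs <;> simp
    refine (h0 _).trans ?_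
    rw [one_mul]
    refine (l1_sub_le _ _).trans (add_le_add ((l1_sub_le _ _).trans (add_le_add ?_ ?_)) ?_)
    · simp
    · rw [headsMap_single]
      split_ifs
      · exact l1_subdivision_le (by simpa using hf)
      · simp
    · refine (l1_map_le _ fun f' hf' => ih V f' (wordBoundary_mem_chainsOn hf hf').2).trans ?_
      have := l1_wordBoundary_le f
      rw [hf] at this
      push_cast at this
      gcongr

end Heads

/-- Uniform acyclicity passes from the complex of words to the complex of flags of words. -/
lemma fillable_flagsOf (p : ℕ) (K : ℝ) (hK : 0 ≤ K) : ∃ K' : ℝ, 0 ≤ K' ∧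
    ∀ (V : Type u) [Inhabited V] (F : Set (List V)), SublistClosed F → [] ∈ F →
      (∀ w ∈ F, w.Nodup) → Fillable F p K → Fillable (flagsOf F) p K' := by
  obtain ⟨H, hH, hhom⟩ := exists_l1_flagHomotopy_le.{u} p
  refine ⟨(p + 1).factorial * K + H, by positivity, fun V _ F hF h0 hnd hfill c hc hd => ?_⟩
  have hLd : dWord (headsMap c) = 0 := by
    have : (dWord ∘ₗ headsMap) c = (headsMap ∘ₗ dWord) c := by
      refine map_eq_of_supported _ _ (fun f hf => ?_) hc
      simp only [LinearMap.comp_apply, dWord_single, one_smul]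
      exact (headsMap_wordBoundary hnd hf.1).symm
    simpa [hd] using this
  obtain ⟨b, hb, hbd, hbn⟩ := hfill _ (headsMap_mem hF h0 hc) hLd
  refine ⟨subdivision (p + 1) b + flagHomotopy p c, Submodule.add_mem _ ?_ ?_, ?_, ?_⟩
  · refine map_mem_of_supported _ (fun w hw => ?_) hb
    exact chainsOn_mono (flagsOf_mono fun x hx => hF w hw.1 x hx) _ (subdivision_mem hw.2)
  · refine map_mem_of_supported _ (fun f hf => ?_) hc
    cases p with
    | zero => exact Submodule.zero_mem _
    | succ p =>
      refine chainsOn_mono (flagsOf_mono fun x hx => ?_) _ (flagHomotopy_mem hf.1 hf.2).1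
      refine hF f.headI (hf.1.2 _ (headI_mem ?_)).1 x hx
      rintro rfl
      simpa using hf.2
  · have h1 : dWord (subdivision (p + 1) b) = subdivision p (dWord b) := by
      refine map_eq_of_supported (dWord ∘ₗ subdivision (p + 1)) (subdivision p ∘ₗ dWord)
        (fun w hw => ?_) hb
      simp only [LinearMap.comp_apply, dWord_single, one_smul]
      exact dWord_subdivision p hw.2
    rw [map_add, h1, hbd, dWord_flagHomotopy hnd hc hd]
    exact add_sub_cancel _ _
  · have h1 := l1_add_le (subdivision (p + 1) b) (flagHomotopy p c)
    have h2 : l1 (subdivision (p + 1) b) ≤ (p + 1).factorial * l1 b :=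
      l1_map_le _ fun w hw => l1_subdivision_le (hb hw).2
    have h3 : l1 (flagHomotopy p c) ≤ H * l1 c := l1_map_le _ fun f hf => hhom V f (hc hf).2
    have h4 := l1_headsMap_le c
    have h5 : ((p + 1).factorial : ℝ) * l1 b ≤ (p + 1).factorial * (K * (1 * l1 c)) := by
      gcongr
      exact hbn.trans (by gcongr)
    linarith

end Flags

/-! ### The order complex of a poset of sequences -/

section Comparison

/-- The words underlying a set of sequences, together with the empty word. -/
def wordsOf {V : Type u} (S : Set (OrderedSeq V)) : Set (List V) :=
  {w | w = [] ∨ ∃ x ∈ S, x.toList = w}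

lemma wordBoundary_ofFn {W : Type*} (n : ℕ) (y : Fin (n + 1) → W) :
    wordBoundary (List.ofFn y) =
      ∑ i : Fin (n + 1), (-1 : ℝ) ^ (i : ℕ) •
        Finsupp.single (List.ofFn fun j : Fin n => y (i.succAbove j)) (1 : ℝ) := by
  induction n with
  | zero => simp [wordBoundary]
  | succ n ih =>
    rw [List.ofFn_succ, wordBoundary, ih, Fin.sum_univ_succ (n := n + 1), map_sum, sub_eq_add_neg,
      ← Finset.sum_neg_distrib]
    congr 1
    · simp
    · refine Finset.sum_congr rfl fun i _ => ?_
      rw [map_smul, consMap_single, List.ofFn_succ]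
      simp [pow_succ]

variable {V : Type u} {S : Set (OrderedSeq V)}

/-- The word of words underlying a flag of sequences, from the largest to the smallest. -/
def flagWord {q : ℕ} (x : Simplices S q) : List (List V) :=
  List.ofFn fun i => (x.1 i.rev).1.toList

lemma toList_injective : Function.Injective (OrderedSeq.toList : OrderedSeq V → List V) := by
  rintro ⟨a, _, _⟩ ⟨b, _, _⟩ rfl
  rfl

lemma flagWord_injective (q : ℕ) : Function.Injective (flagWord : Simplices S q → _) := by
  intro x y h
  have h1 := List.ofFn_injective h
  apply Subtype.ext
  funext i
  have h2 := congrFun h1 i.rev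
  simp only [Fin.rev_rev] at h2
  exact Subtype.ext (toList_injective h2)

lemma flagWord_mem {q : ℕ} (x : Simplices S q) :
    flagWord x ∈ flagsOf (wordsOf S) ∧ (flagWord x).length = q + 1 := by
  refine ⟨⟨?_, ?_⟩, by simp [flagWord]⟩
  · rw [flagWord, List.pairwise_ofFn]
    intro i j hij
    have h := x.2 (Fin.rev_lt_rev.2 hij)
    refine ⟨h.le, fun he => h.ne ?_⟩
    exact Subtype.ext (toList_injective he)
  · intro w hw
    obtain ⟨i, rfl⟩ := (List.mem_ofFn' _ _).1 hw
    exact ⟨Or.inr ⟨_, (x.1 i.rev).2, rfl⟩, (x.1 i.rev).1.ne_nil⟩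

lemma exists_flagWord {q : ℕ} {f : List (List V)} (hf : f ∈ flagsOf (wordsOf S))
    (hl : f.length = q + 1) : ∃ x : Simplices S q, flagWord x = f := by
  obtain ⟨y, rfl⟩ : ∃ y : Fin (q + 1) → List V, List.ofFn y = f := by
    refine ⟨fun i => f.get (i.cast hl.symm), ?_⟩
    apply List.ext_get (by simp [hl])
    intro i h1 h2
    simp [-List.ofFn_succ]
  have hy : ∀ i, ∃ z ∈ S, z.toList = y i := by
    intro i
    obtain ⟨h1, h2⟩ := hf.2 (y i) ((List.mem_ofFn' _ _).2 ⟨i, rfl⟩)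
    exact h1.resolve_left h2
  choose z hz hzy using hy
  refine ⟨⟨fun i => ⟨z i.rev, hz i.rev⟩, ?_⟩, ?_⟩
  · intro i j hij
    have h := (List.pairwise_ofFn.1 hf.1) (Fin.rev_lt_rev.2 hij)
    rw [← hzy, ← hzy] at h
    refine lt_of_le_of_ne (show (z i.rev).toList.Sublist (z j.rev).toList from h.1) ?_
    intro he
    exact h.2 (congrArg (fun w : S => w.1.toList) he)
  · simp [flagWord, hzy]

/-- The embedding of the simplicial chains of the order complex into the complex of words. -/
def flagChain (S : Set (OrderedSeq V)) (q : ℕ) : Chains S q →ₗ[ℝ] (List (List V) →₀ ℝ) :=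
  Finsupp.lmapDomain ℝ ℝ flagWord

lemma flagChain_single {q : ℕ} (x : Simplices S q) (r : ℝ) :
    flagChain S q (Finsupp.single x r) = Finsupp.single (flagWord x) r := by
  simp [flagChain]

lemma flagChain_injective (q : ℕ) : Function.Injective (flagChain S q) :=
  Finsupp.mapDomain_injective (flagWord_injective q)

lemma flagChain_mem {q : ℕ} (c : Chains S q) :
    flagChain S q c ∈ chainsOn (flagsOf (wordsOf S)) (q + 1) := by
  refine map_mem_of_supported (S := Set.univ) _ (fun x _ => ?_)
    ((Finsupp.mem_supported ℝ c).2 (Set.subset_univ _))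
  rw [flagChain_single]
  apply single_mem_supported
  exact flagWord_mem x

lemma l1_flagChain {q : ℕ} (c : Chains S q) : l1 (flagChain S q c) = l1Norm c :=
  Finsupp.sum_mapDomain_index_inj (flagWord_injective q)

lemma exists_flagChain {q : ℕ} {c : List (List V) →₀ ℝ}
    (hc : c ∈ chainsOn (flagsOf (wordsOf S)) (q + 1)) :
    ∃ c' : Chains S q, flagChain S q c' = c := by
  refine ⟨Finsupp.comapDomain flagWord c (flagWord_injective q).injOn, ?_⟩
  refine Finsupp.mapDomain_comapDomain _ (flagWord_injective q) _ fun f hf => ?_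
  obtain ⟨x, hx⟩ := exists_flagWord (hc hf).1 (hc hf).2
  exact ⟨x, hx⟩

/-- The reversal of the flags changes the boundary by a sign. -/
lemma dWord_flagChain (q : ℕ) (c : Chains S (q + 1)) :
    dWord (flagChain S (q + 1) c) = (-1 : ℝ) ^ (q + 1) • flagChain S q (boundary S q c) := by
  change (dWord ∘ₗ flagChain S (q + 1)) c =
    ((-1 : ℝ) ^ (q + 1) • (flagChain S q ∘ₗ boundary S q)) c
  refine map_eq_of_supported (S := Set.univ) _ _ (fun x _ => ?_)
    ((Finsupp.mem_supported ℝ c).2 (Set.subset_univ _))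
  have hb : boundary S q (Finsupp.single x 1) =
      ∑ i : Fin (q + 2), (-1 : ℝ) ^ (i : ℕ) • Finsupp.single (face i x) (1 : ℝ) := by
    simp [boundary]
  simp only [LinearMap.comp_apply, LinearMap.smul_apply]
  rw [hb, flagChain_single, dWord_single, one_smul, flagWord, wordBoundary_ofFn, map_sum,
    Finset.smul_sum, ← Equiv.sum_comp Fin.revPerm]
  refine Finset.sum_congr rfl fun i _ => ?_
  rw [map_smul, flagChain_single, smul_smul]
  congr 1
  · rw [Fin.revPerm_apply, Fin.val_rev, ← pow_add]
    have h1 : q + 1 + (i : ℕ) = (q + 2 - ((i : ℕ) + 1)) + 2 * i := by omega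
    rw [h1, pow_add _ _ (2 * (i : ℕ)), pow_mul]
    simp
  · simp only [flagWord, face, Fin.revPerm_apply, Fin.rev_succAbove, Fin.rev_rev]

lemma dWord_flagChain_zero (c : Chains S 0) :
    dWord (flagChain S 0 c) = Finsupp.single [] (augmentation S c) := by
  change (dWord ∘ₗ flagChain S 0) c = (Finsupp.lsingle [] ∘ₗ augmentation S) c
  refine map_eq_of_supported (S := Set.univ) _ _ (fun x _ => ?_)
    ((Finsupp.mem_supported ℝ c).2 (Set.subset_univ _))
  simp [flagChain_single, augmentation, flagWord, wordBoundary]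

lemma boundaries_le_reducedCycles (q : ℕ) : boundaries S q ≤ reducedCycles S q := by
  rintro _ ⟨b, rfl⟩
  have h : dWord (flagChain S q (boundary S q b)) = 0 := by
    have h1 := congrArg dWord (dWord_flagChain q b)
    rw [dWord_dWord, map_smul, eq_comm, smul_eq_zero] at h1
    exact h1.resolve_left (pow_ne_zero _ (by norm_num))
  cases q with
  | zero =>
    rw [dWord_flagChain_zero, Finsupp.single_eq_zero] at h
    exact h
  | succ q =>
    rw [dWord_flagChain, smul_eq_zero] at h
    have h2 := h.resolve_left (pow_ne_zero _ (by norm_num))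
    exact flagChain_injective q (h2.trans (map_zero _).symm)

lemma exists_boundary_eq {q : ℕ} {K : ℝ} (h : Fillable (flagsOf (wordsOf S)) (q + 1) K)
    {c : Chains S q} (hc : c ∈ reducedCycles S q) :
    ∃ b : Chains S (q + 1), boundary S q b = c ∧ l1Norm b ≤ K * l1Norm c := by
  have hd : dWord (flagChain S q c) = 0 := by
    cases q with
    | zero =>
      have : augmentation S c = 0 := hc
      rw [dWord_flagChain_zero, this, Finsupp.single_zero]
    | succ q =>
      have : boundary S q c = 0 := hc
      rw [dWord_flagChain, this, map_zero, smul_zero]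
  obtain ⟨b, hb, hbd, hbn⟩ := h _ (flagChain_mem c) hd
  obtain ⟨b', rfl⟩ := exists_flagChain hb
  refine ⟨(-1 : ℝ) ^ (q + 1) • b', ?_, ?_⟩
  · apply flagChain_injective q
    rw [map_smul, map_smul, ← dWord_flagChain, hbd]
  · rw [← l1_flagChain, ← l1_flagChain, map_smul, l1_smul]
    simpa using hbn

lemma uniformlyAcyclicWith_of_fillable {d : ℤ} {K : ℝ}
    (h : ∀ p : ℕ, (p : ℤ) ≤ d + 1 → Fillable (flagsOf (wordsOf S)) p K) :
    UniformlyAcyclicWith S d K := by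
  have hubc : ∀ q : ℕ, (q : ℤ) ≤ d → UBC S q K := fun q hq c hc =>
    exists_boundary_eq (h (q + 1) (by push_cast; omega)) (boundaries_le_reducedCycles q hc)
  refine ⟨fun hd => ⟨?_, fun q hq => ⟨fun c hc => ?_, K, hubc q hq⟩⟩, hubc⟩
  · -- a filling of the empty word contains a vertex
    obtain ⟨b, hb, hbd, -⟩ := h 0 (by push_cast; omega) (Finsupp.single [] 1) (by
      apply single_mem_supported
      exact ⟨⟨List.Pairwise.nil, by simp⟩, rfl⟩) (by simp [wordBoundary])
    have hb0 : b ≠ 0 := by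
      rintro rfl
      rw [map_zero, eq_comm, Finsupp.single_eq_zero] at hbd
      exact one_ne_zero hbd
    obtain ⟨f, hf⟩ := Finsupp.support_nonempty_iff.2 hb0
    obtain ⟨x, -⟩ := exists_flagWord (hb hf).1 (hb hf).2
    exact ⟨x.1 0⟩
  · obtain ⟨b, hb, -⟩ := exists_boundary_eq (h (q + 1) (by push_cast; omega)) hc
    exact ⟨b, hb⟩

end Comparison

/-! ### Unimodularity modulo a set and stable range -/

section Unimodular

/-- A list of vectors is unimodular modulo `Z` if its entries are distinct and have dual
functionals that vanish on `Z`. -/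
def UnimodularMod (R : Type*) {M : Type*} [Ring R] [AddCommGroup M] [Module Rᵐᵒᵖ M]
    (Z : Set M) (l : List M) : Prop :=
  l.Nodup ∧ ∀ x ∈ l, ∃ ψ : M →ₗ[Rᵐᵒᵖ] R, ψ x = 1 ∧ (∀ y ∈ l, y ≠ x → ψ y = 0) ∧ ∀ z ∈ Z, ψ z = 0

variable {R : Type*} {M : Type*} [Ring R] [AddCommGroup M] [Module Rᵐᵒᵖ M]

lemma map_op_smul (ψ : M →ₗ[Rᵐᵒᵖ] R) (r : R) (x : M) :
    ψ (MulOpposite.op r • x) = ψ x * r := by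
  rw [map_smul, op_smul_eq_mul]

lemma UnimodularMod.sublist {Z : Set M} {l l' : List M} (h : UnimodularMod R Z l)
    (hl : l'.Sublist l) : UnimodularMod R Z l' := by
  refine ⟨h.1.sublist hl, fun x hx => ?_⟩
  obtain ⟨ψ, h1, h2, h3⟩ := h.2 x (hl.subset hx)
  exact ⟨ψ, h1, fun y hy => h2 y (hl.subset hy), h3⟩

/-- If `v` is split off by a functional that vanishes on `Z`, then unimodularity of a list that
contains `v` can be tested modulo `v`. -/
lemma unimodularMod_append_cons_iff [Nontrivial R] {Z : Set M} {v : M} {θ : M →ₗ[Rᵐᵒᵖ] R}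
    (hv : θ v = 1) (hZ : ∀ z ∈ Z, θ z = 0) (l r : List M) :
    UnimodularMod R Z (l ++ v :: r) ↔ UnimodularMod R (insert v Z) (l ++ r) := by
  classical
  constructor
  · rintro ⟨hn, h⟩
    have hn' : v ∉ l ++ r ∧ (l ++ r).Nodup := List.nodup_cons.1 (List.nodup_middle.1 hn)
    refine ⟨hn'.2, fun x hx => ?_⟩
    have hsub : ∀ y ∈ l ++ r, y ∈ l ++ v :: r := by
      intro y hy
      simp only [List.mem_append, List.mem_cons] at hy ⊢
      tauto
    obtain ⟨ψ, h1, h2, h3⟩ := h x (hsub x hx)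
    refine ⟨ψ, h1, fun y hy => h2 y (hsub y hy), ?_⟩
    rintro z (rfl | hz)
    · exact h2 z (by simp) (by rintro rfl; exact hn'.1 hx)
    · exact h3 z hz
  · rintro ⟨hn, h⟩
    have hvn : v ∉ l ++ r := by
      intro hvl
      obtain ⟨ψ, h1, -, h3⟩ := h v hvl
      rw [h3 v (Set.mem_insert _ _)] at h1
      exact zero_ne_one h1
    choose! ψ h1 h2 h3 using h
    refine ⟨List.nodup_middle.2 (List.nodup_cons.2 ⟨hvn, hn⟩), fun x hx => ?_⟩
    have hx' : x = v ∨ x ∈ l ++ r := by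
      simp only [List.mem_append, List.mem_cons] at hx ⊢
      tauto
    have hsub : ∀ y ∈ l ++ v :: r, y ≠ v → y ∈ l ++ r := by
      intro y hy hyv
      simp only [List.mem_append, List.mem_cons] at hy ⊢
      tauto
    rcases hx' with rfl | hx
    · -- correct `θ` so that it vanishes on the other vectors
      refine ⟨θ - ∑ y ∈ (l ++ r).toFinset, θ y • ψ y, ?_, ?_, ?_⟩
      · rw [LinearMap.sub_apply, LinearMap.sum_apply, hv, Finset.sum_eq_zero, sub_zero]
        intro y hy
        rw [LinearMap.smul_apply, h3 y (List.mem_toFinset.1 hy) _ (Set.mem_insert _ _), smul_zero]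
      · intro y hy hyx
        have hy' := hsub y hy hyx
        rw [LinearMap.sub_apply, LinearMap.sum_apply, sub_eq_zero,
          Finset.sum_eq_single_of_mem y (List.mem_toFinset.2 hy')]
        · rw [LinearMap.smul_apply, h1 y hy', smul_eq_mul, mul_one]
        · intro z hz hzy
          rw [LinearMap.smul_apply, h2 z (List.mem_toFinset.1 hz) y hy' hzy.symm, smul_zero]
      · intro z hz
        rw [LinearMap.sub_apply, LinearMap.sum_apply, hZ z hz, Finset.sum_eq_zero, sub_zero]
        intro y hy
        rw [LinearMap.smul_apply, h3 y (List.mem_toFinset.1 hy) _ (Set.mem_insert_of_mem _ hz),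
          smul_zero]
    · refine ⟨ψ x, h1 x hx, fun y hy hyx => ?_, fun z hz => h3 x hx z (Set.mem_insert_of_mem _ hz)⟩
      by_cases hyv : y = v
      · rw [hyv]
        exact h3 x hx v (Set.mem_insert _ _)
      · exact h2 x hx y (hsub y hy hyv) hyx

lemma UnimodularMod.append_singleton [Nontrivial R] {Z : Set M} {w : List M}
    (h : UnimodularMod R Z w) {β : M →ₗ[Rᵐᵒᵖ] R} {y : M} (hy : β y = 1) (hw : ∀ x ∈ w, β x = 0)
    (hZ : ∀ z ∈ Z, β z = 0) : UnimodularMod R Z (w ++ [y]) := by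
  rw [unimodularMod_append_cons_iff hy hZ, List.append_nil]
  refine ⟨h.1, fun x hx => ?_⟩
  obtain ⟨ψ, h1, h2, h3⟩ := h.2 x hx
  refine ⟨ψ - ψ y • β, ?_, fun x' hx' hne => ?_, ?_⟩
  · simp [h1, hw x hx]
  · simp [h2 x' hx' hne, hw x' hx']
  · rintro z (rfl | hz)
    · simp [hy]
    · simp [h3 z hz, hZ z hz]

lemma isUnimodular_iff [Nontrivial R] (l : List M) :
    IsUnimodular R l ↔ UnimodularMod R ∅ l := by
  classical
  constructor
  · rintro ⟨hli, Q, hQ⟩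
    refine ⟨List.nodup_iff_injective_get.2 hli.injective, fun x hx => ?_⟩
    obtain ⟨i, rfl⟩ := List.get_of_mem hx
    have hrange : Set.range l.get = {x | x ∈ l} := by
      ext y
      exact List.mem_iff_get.symm
    rw [← hrange] at hQ
    have hcoord : ∀ j,
        (Module.Basis.span hli).coord i ((Submodule.projectionOnto _ Q hQ) (l.get j)) =
        if j = i then 1 else 0 := by
      intro j
      have hj : l.get j ∈ Submodule.span Rᵐᵒᵖ (Set.range l.get) :=
        Submodule.subset_span ⟨j, rfl⟩
      have h1 := Submodule.projectionOnto_apply_left hQ ⟨l.get j, hj⟩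
      have h2 : (⟨l.get j, hj⟩ : Submodule.span Rᵐᵒᵖ (Set.range l.get)) =
          Module.Basis.span hli j := by
        exact (Module.Basis.span_apply hli j).symm
      rw [h1, h2, Module.Basis.coord_apply, Module.Basis.repr_self, Finsupp.single_apply]
    refine ⟨(LinearMap.toSpanSingleton Rᵐᵒᵖ R 1) ∘ₗ (Module.Basis.span hli).coord i ∘ₗ
      Submodule.projectionOnto _ Q hQ, ?_, ?_, by simp⟩
    · rw [LinearMap.comp_apply, LinearMap.comp_apply, hcoord]
      simp
    · intro y hy hne
      obtain ⟨j, rfl⟩ := List.get_of_mem hy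
      rw [LinearMap.comp_apply, LinearMap.comp_apply, hcoord, if_neg (by rintro rfl; exact hne rfl)]
      simp
  · rintro ⟨hn, h⟩
    choose! ψ h1 h2 _ using h
    have hsum : ∀ (x : M), x ∈ l → ∀ m : M,
        ψ x (∑ y ∈ l.toFinset, MulOpposite.op (ψ y m) • y) = ψ x m := by
      intro x hx m
      rw [map_sum, Finset.sum_eq_single_of_mem x (List.mem_toFinset.2 hx)]
      · rw [map_op_smul, h1 x hx, one_mul]
      · intro y hy hyx
        rw [map_op_smul, h2 x hx y (List.mem_toFinset.1 hy) hyx, zero_mul]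
    have hmem : ∀ m : M, ∑ y ∈ l.toFinset, MulOpposite.op (ψ y m) • y ∈
        Submodule.span Rᵐᵒᵖ {x | x ∈ l} := fun m =>
      Submodule.sum_mem _ fun y hy => Submodule.smul_mem _ _
        (Submodule.subset_span (List.mem_toFinset.1 hy))
    refine ⟨?_, ⨅ x ∈ l.toFinset, LinearMap.ker (ψ x), ?_⟩
    · rw [Fintype.linearIndependent_iff]
      intro g hg i
      have h3 := congrArg (ψ (l.get i)) hg
      rw [map_sum, map_zero, Finset.sum_eq_single i] at h3
      · rw [map_smul, h1 _ (List.get_mem l i)] at h3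
        simpa using h3
      · intro j _ hji
        rw [map_smul, h2 _ (List.get_mem l i) _ (List.get_mem l j), smul_zero]
        intro he
        exact hji (List.nodup_iff_injective_get.1 hn he)
      · simp
    · constructor
      · rw [Submodule.disjoint_def]
        intro m hm hmQ
        have hrep : ∑ y ∈ l.toFinset, MulOpposite.op (ψ y m) • y = m := by
          clear hmQ
          induction hm using Submodule.span_induction with
          | mem x hx =>
            rw [Finset.sum_eq_single_of_mem x (List.mem_toFinset.2 hx)]
            · rw [h1 x hx, MulOpposite.op_one, one_smul]
            · intro y hy hyx
              rw [h2 y (List.mem_toFinset.1 hy) x hx hyx.symm, MulOpposite.op_zero, zero_smul]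
          | zero => simp
          | add x y _ _ hx hy =>
            simp only [map_add, MulOpposite.op_add, add_smul, Finset.sum_add_distrib] at hx hy ⊢
            rw [hx, hy]
          | smul r x _ hx =>
            have h3 : ∀ y, MulOpposite.op (ψ y (r • x)) • y = r • MulOpposite.op (ψ y x) • y := by
              intro y
              rw [← MulOpposite.op_unop r, map_op_smul, MulOpposite.op_mul, mul_smul]
            simp only [h3, ← Finset.smul_sum, hx]
        rw [← hrep]
        refine Finset.sum_eq_zero fun y hy => ?_
        simp only [Submodule.mem_iInf, LinearMap.mem_ker] at hmQ
        rw [hmQ y hy, MulOpposite.op_zero, zero_smul]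
      · rw [codisjoint_iff, eq_top_iff]
        intro m _
        refine Submodule.mem_sup.2 ⟨_, hmem m, m - ∑ y ∈ l.toFinset, MulOpposite.op (ψ y m) • y, ?_,
          add_sub_cancel _ _⟩
        simp only [Submodule.mem_iInf, LinearMap.mem_ker]
        intro x hx
        rw [map_sub, hsum x (List.mem_toFinset.1 hx), sub_self]

/-- The stable range condition in terms of coefficient vectors. -/
lemma StableRange.exists_shorten [Nontrivial R] {s m : ℕ} (h : StableRange R (s + 1)) (hm : s ≤ m)
    {r c : Fin (m + 1) → R} (hr : ∑ i, c i * r i = 1) :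
    ∃ t c' : Fin m → R, ∑ i, c' i * (r i.castSucc + t i * r (Fin.last m)) = 1 := by
  have key : ∀ (n : ℕ) (x : Fin n → R), IsUnimodular R [x] ↔
      ∃ c : Fin n → R, ∑ i, c i * x i = 1 := by
    intro n x
    rw [isUnimodular_iff]
    constructor
    · rintro ⟨-, h⟩
      obtain ⟨ψ, hψ, -⟩ := h x (by simp)
      refine ⟨fun i => ψ (Pi.single i 1), ?_⟩
      have hx : x = ∑ i, MulOpposite.op (x i) • (Pi.single i 1 : Fin n → R) := by
        ext j
        simp [Finset.sum_apply, Pi.single_apply]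
      have h1 := congrArg ψ hx
      rw [hψ, map_sum] at h1
      simpa only [map_op_smul] using h1.symm
    · rintro ⟨c, hc⟩
      refine ⟨by simp, fun y hy => ?_⟩
      obtain rfl : y = x := by simpa using hy
      refine ⟨∑ i, c i • LinearMap.proj i, ?_, ?_, by simp⟩
      · simpa [LinearMap.sum_apply] using hc
      · intro y hy hne
        exact absurd (by simpa using hy) hne
  obtain ⟨t, ht⟩ := h m (by omega) r ((key _ r).2 ⟨c, hr⟩)
  obtain ⟨c', hc'⟩ := (key _ _).1 ht
  exact ⟨t, c', hc'⟩

lemma stableRange_of_stableRank_eq {R : Type*} [Ring R] {s : ℕ} (h : stableRank R = (s : ℕ∞)) :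
    1 ≤ s ∧ StableRange R (s + 1) := by
  have hne : {s : ℕ∞ | ∃ l : ℕ, s = l ∧ 1 ≤ l ∧ StableRange R (l + 1)}.Nonempty := by
    by_contra hcon
    rw [Set.not_nonempty_iff_eq_empty] at hcon
    rw [stableRank, hcon, sInf_empty] at h
    exact ENat.natCast_ne_top s h.symm
  obtain ⟨l, hl, h1, h2⟩ := csInf_mem hne
  have : s = l := by
    have := h.symm.trans hl
    exact_mod_cast this
  subst this
  exact ⟨h1, h2⟩

end Unimodular

/-! ### Split bases and their cosets -/

section SplitBasis

/-- A basis `f` of a free submodule of rank `n`, together with a dual family `φ` of functionals that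
vanish on `Z`. -/
structure SplitBasis (R : Type*) {M : Type*} [Ring R] [AddCommGroup M] [Module Rᵐᵒᵖ M]
    (Z : Set M) (n : ℕ) where
  f : Fin n → M
  φ : Fin n → M →ₗ[Rᵐᵒᵖ] R
  dual : ∀ i j, φ i (f j) = if i = j then 1 else 0
  vanish : ∀ i, ∀ z ∈ Z, φ i z = 0

variable {R : Type*} {M : Type*} [Ring R] [AddCommGroup M] [Module Rᵐᵒᵖ M] {Z : Set M} {n : ℕ}

/-- The submodule spanned by a split basis. -/
def SplitBasis.span (D : SplitBasis R Z n) : Submodule Rᵐᵒᵖ M :=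
  Submodule.span Rᵐᵒᵖ (Set.range D.f)

/-- The coset of `a` with respect to the submodule spanned by a split basis. -/
def SplitBasis.coset (D : SplitBasis R Z n) (a : M) : Set M := {x | x - a ∈ D.span}

lemma SplitBasis.mem_coset {D : SplitBasis R Z n} {a x : M} : x ∈ D.coset a ↔ x - a ∈ D.span :=
  Iff.rfl

lemma SplitBasis.f_mem (D : SplitBasis R Z n) (i : Fin n) : D.f i ∈ D.span :=
  Submodule.subset_span ⟨i, rfl⟩

lemma SplitBasis.map_eq_of_mem_coset (D : SplitBasis R Z n) {β : M →ₗ[Rᵐᵒᵖ] R}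
    (hβ : ∀ i, β (D.f i) = 0) {a x : M} (hx : x ∈ D.coset a) : β x = β a := by
  have h : D.span ≤ LinearMap.ker β := by
    rw [SplitBasis.span, Submodule.span_le]
    rintro _ ⟨i, rfl⟩
    exact hβ i
  have := h hx
  rwa [LinearMap.mem_ker, map_sub, sub_eq_zero] at this

lemma SplitBasis.mem_coset_self (D : SplitBasis R Z n) (a : M) : a ∈ D.coset a := by
  simp [SplitBasis.coset]

lemma SplitBasis.coset_subset {Z' : Set M} {m : ℕ} {D : SplitBasis R Z n}
    {D' : SplitBasis R Z' m} (h : ∀ i, D'.f i ∈ D.span) {a a' : M} (ha : a' ∈ D.coset a) :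
    D'.coset a' ⊆ D.coset a := by
  intro x hx
  have h1 : D'.span ≤ D.span := by
    rw [SplitBasis.span, Submodule.span_le]
    rintro _ ⟨i, rfl⟩
    exact h i
  have h2 := D.span.add_mem (h1 hx) ha
  rwa [sub_add_sub_cancel] at h2

/-- The split basis without its last vector. -/
def SplitBasis.init (D : SplitBasis R Z (n + 1)) : SplitBasis R Z n where
  f i := D.f i.castSucc
  φ i := D.φ i.castSucc
  dual i j := by simp [D.dual]
  vanish i := D.vanish _

/-- A split basis on which `β` vanishes remains one modulo a further vector `x` with `β x = 1`. -/
def SplitBasis.insert (D : SplitBasis R Z n) {β : M →ₗ[Rᵐᵒᵖ] R} (hf : ∀ i, β (D.f i) = 0)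
    (hZ : ∀ z ∈ Z, β z = 0) {x : M} (hx : β x = 1) : SplitBasis R (insert x Z) n where
  f := D.f
  φ i := D.φ i - D.φ i x • β
  dual i j := by simp [D.dual, hf]
  vanish i := by
    rintro z (rfl | hz)
    · simp [hx]
    · simp [D.vanish i z hz, hZ z hz]

/-- If the rank is at least the stable rank, the functionals can be changed so that a given
unimodular vector has unimodular coordinates. -/
lemma SplitBasis.exists_unimodular_coordinates [Nontrivial R] {s : ℕ} (hR : StableRange R (s + 1))
    (hs : s ≤ n) (D : SplitBasis R Z n) {v : M} {ψ : M →ₗ[Rᵐᵒᵖ] R} (hv : ψ v = 1)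
    (hZ : ∀ z ∈ Z, ψ z = 0) :
    ∃ (D' : SplitBasis R Z n) (c : Fin n → R), D'.f = D.f ∧ ∑ i, c i * D'.φ i v = 1 := by
  -- the component of `ψ` that vanishes on the span of the basis
  set χ : M →ₗ[Rᵐᵒᵖ] R := ψ - ∑ i, ψ (D.f i) • D.φ i with hχ
  have hχf : ∀ j, χ (D.f j) = 0 := by
    intro j
    simp [hχ, LinearMap.sum_apply, D.dual]
  have hχZ : ∀ z ∈ Z, χ z = 0 := by
    intro z hz
    simp [hχ, LinearMap.sum_apply, D.vanish _ z hz, hZ z hz]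
  obtain ⟨t, c, hc⟩ := hR.exists_shorten hs (r := Fin.snoc (fun i => D.φ i v) (χ v))
    (c := Fin.snoc (fun i => ψ (D.f i)) 1) (by
      rw [Fin.sum_univ_castSucc]
      simp [hχ, LinearMap.sum_apply, hv])
  refine ⟨⟨D.f, fun i => D.φ i + t i • χ, fun i j => by simp [hχf, D.dual], fun i z hz => by
    simp [hχZ z hz, D.vanish i z hz]⟩, c, rfl, ?_⟩
  simpa using hc

/-- If the rank exceeds the stable rank, a unimodular vector `v` can be split off: there are `γ` in
the span and a functional `θ` with `θ v = θ γ = 1`, and in the kernel of `θ` there is a split basis,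
modulo `v`, of rank one less. -/
lemma SplitBasis.exists_split_off [Nontrivial R] {s : ℕ} (hR : StableRange R (s + 1))
    (hs : s ≤ n) (D : SplitBasis R Z (n + 1)) {v : M} {ψ : M →ₗ[Rᵐᵒᵖ] R} (hv : ψ v = 1)
    (hZ : ∀ z ∈ Z, ψ z = 0) :
    ∃ (D' : SplitBasis R (Insert.insert v Z) n) (θ : M →ₗ[Rᵐᵒᵖ] R) (γ : M),
      (∀ i, D'.f i ∈ D.span) ∧ γ ∈ D.span ∧ θ γ = 1 ∧ θ v = 1 ∧ (∀ i, θ (D'.f i) = 0) ∧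
        ∀ z ∈ Z, θ z = 0 := by
  obtain ⟨D₁, c₁, hf, hc₁⟩ := D.exists_unimodular_coordinates hR (by omega) hv hZ
  obtain ⟨t, c, hc⟩ := hR.exists_shorten hs hc₁
  have hspan : ∀ i, D₁.f i ∈ D.span := fun i => by rw [hf]; exact D.f_mem i
  -- elementary row operations make the last coordinate of `v` equal to `1`
  set φ₂ : Fin n → M →ₗ[Rᵐᵒᵖ] R := fun i => D₁.φ i.castSucc + t i • D₁.φ (Fin.last n) with hφ₂
  set γ : M := D₁.f (Fin.last n) - ∑ i : Fin n, MulOpposite.op (t i) • D₁.f i.castSucc with hγ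
  set e : Fin n → R := fun i => (1 - D₁.φ (Fin.last n) v) * c i with he
  set θ : M →ₗ[Rᵐᵒᵖ] R := D₁.φ (Fin.last n) + ∑ i, e i • φ₂ i with hθ
  have hd1 : ∀ i j : Fin n, D₁.φ i.castSucc (D₁.f j.castSucc) = if i = j then 1 else 0 := by
    intro i j; simp [D₁.dual]
  have hd2 : ∀ j : Fin n, D₁.φ (Fin.last n) (D₁.f j.castSucc) = 0 := by
    intro j; rw [D₁.dual, if_neg (Fin.castSucc_lt_last j).ne']
  have hd3 : ∀ i : Fin n, D₁.φ i.castSucc (D₁.f (Fin.last n)) = 0 := by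
    intro i; rw [D₁.dual, if_neg (Fin.castSucc_lt_last i).ne]
  have hd4 : D₁.φ (Fin.last n) (D₁.f (Fin.last n)) = 1 := by simp [D₁.dual]
  have hφf : ∀ i j : Fin n, φ₂ i (D₁.f j.castSucc) = if i = j then 1 else 0 := by
    intro i j; simp [hφ₂, hd1, hd2]
  have hφγ : ∀ i, φ₂ i γ = 0 := by
    intro i
    simp [hφ₂, hγ, map_sum, hd1, hd2, hd3, hd4]
  have hθγ : θ γ = 1 := by
    simp only [hθ, LinearMap.add_apply, LinearMap.sum_apply, LinearMap.smul_apply, hφγ]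
    simp [hγ, map_sum, hd2, hd4]
  have hθf : ∀ j : Fin n, θ (D₁.f j.castSucc) = e j := by
    intro j
    simp [hθ, LinearMap.sum_apply, hφf, hd2]
  have hθv : θ v = 1 := by
    have h1 : ∑ i, e i * φ₂ i v = (1 - D₁.φ (Fin.last n) v) *
        ∑ i, c i * (D₁.φ i.castSucc v + t i * D₁.φ (Fin.last n) v) := by
      rw [Finset.mul_sum]
      refine Finset.sum_congr rfl fun i _ => ?_
      simp [he, hφ₂, mul_assoc]
    simp only [hθ, LinearMap.add_apply, LinearMap.sum_apply, LinearMap.smul_apply, smul_eq_mul, h1,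
      hc, mul_one]
    exact add_sub_cancel _ _
  have hθZ : ∀ z ∈ Z, θ z = 0 := by
    intro z hz
    simp [hθ, hφ₂, LinearMap.sum_apply, D₁.vanish _ z hz]
  have hγs : γ ∈ D.span := Submodule.sub_mem _ (hspan _)
    (Submodule.sum_mem _ fun i _ => Submodule.smul_mem _ _ (hspan _))
  refine ⟨⟨fun j => D₁.f j.castSucc - MulOpposite.op (e j) • γ, fun i => φ₂ i - φ₂ i v • θ,
    fun i j => ?_, fun i => ?_⟩, θ, γ, fun i => ?_, hγs, hθγ, hθv, fun i => ?_, hθZ⟩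
  · simp [hφf, hφγ, hθf, hθγ]
  · rintro z (rfl | hz)
    · simp [hθv]
    · simp [hθZ z hz, hφ₂, D₁.vanish _ z hz]
  · exact Submodule.sub_mem _ (hspan _) (Submodule.smul_mem _ _ hγs)
  · simp [hθf, hθγ]

end SplitBasis

/-! ### Filling the complexes of unimodular sequences in cosets -/

section Induction

/-- The words `w` with letters in `X` such that `(w, v)` is unimodular modulo `Z`. -/
def unimodularWords (R : Type*) {M : Type*} [Ring R] [AddCommGroup M] [Module Rᵐᵒᵖ M]
    (Z X : Set M) (v : List M) : Set (List M) :=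
  {w | (∀ x ∈ w, x ∈ X) ∧ UnimodularMod R Z (w ++ v)}

section Basic

variable {R : Type*} {M : Type*} [Ring R] [AddCommGroup M] [Module Rᵐᵒᵖ M] {Z : Set M}

lemma sublistClosed_unimodularWords (X : Set M) (v : List M) :
    SublistClosed (unimodularWords R Z X v) := fun _ hw _ h =>
  ⟨fun x hx => hw.1 x (h.subset hx), hw.2.sublist (h.append_right v)⟩

lemma linkIn_unimodularWords {X X' : Set M} (hX : X' ⊆ X) {v w : List M} (hw : ∀ x ∈ w, x ∈ X) :
    linkIn (unimodularWords R Z X v) X' w = unimodularWords R Z X' (w ++ v) := by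
  ext u
  constructor
  · rintro ⟨h1, h2⟩
    exact ⟨h1, by simpa using h2.2⟩
  · rintro ⟨h1, h2⟩
    refine ⟨h1, fun x hx => ?_, by simpa using h2⟩
    rcases List.mem_append.1 hx with hx | hx
    · exact hX (h1 x hx)
    · exact hw x hx

lemma unimodularWords_append_cons [Nontrivial R] {v : M} {θ : M →ₗ[Rᵐᵒᵖ] R} (hv : θ v = 1)
    (hZ : ∀ z ∈ Z, θ z = 0) (X : Set M) (l r : List M) :
    unimodularWords R Z X (l ++ v :: r) = unimodularWords R (insert v Z) X (l ++ r) := by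
  ext w
  simp only [unimodularWords, Set.mem_ofPred_eq, ← List.append_assoc,
    unimodularMod_append_cons_iff hv hZ]

end Basic

/-- The words in a coset of a split submodule of rank `n` that can be put in front of a given
unimodular list of length `k` are fillable in length `p` with the constant `K`. -/
def CosetFillable (n s k p : ℕ) (K : ℝ) : Prop :=
  ∀ (R : Type u) [Ring R] [Nontrivial R], StableRange R (s + 1) →
    ∀ (M : Type u) [AddCommGroup M] [Module Rᵐᵒᵖ M] (Z : Set M) (D : SplitBasis R Z n) (a : M)
      (v : List M), v.length = k → UnimodularMod R Z v →
      Fillable (unimodularWords R Z (D.coset a) v) p K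

/-- The variant of `CosetFillable` for the union of two cosets, those of `a` and `a + b`, that are
separated by a functional `β`. -/
def TwoCosetFillable (n s k p : ℕ) (K : ℝ) : Prop :=
  ∀ (R : Type u) [Ring R] [Nontrivial R], StableRange R (s + 1) →
    ∀ (M : Type u) [AddCommGroup M] [Module Rᵐᵒᵖ M] (Z : Set M) (D : SplitBasis R Z n) (a b : M)
      (β : M →ₗ[Rᵐᵒᵖ] R), β b = 1 → β a = 0 → (∀ i, β (D.f i) = 0) → (∀ z ∈ Z, β z = 0) →
      ∀ v : List M, v.length = k → UnimodularMod R Z v →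
      Fillable (unimodularWords R Z (D.coset a ∪ D.coset (a + b)) v) p K

lemma CosetFillable.mono {n s k p : ℕ} {K K' : ℝ} (h : CosetFillable.{u} n s k p K) (hK : K ≤ K') :
    CosetFillable.{u} n s k p K' := fun R _ _ hR M _ _ Z D a v hv huv =>
  (h R hR M Z D a v hv huv).mono hK

lemma TwoCosetFillable.mono {n s k p : ℕ} {K K' : ℝ} (h : TwoCosetFillable.{u} n s k p K)
    (hK : K ≤ K') : TwoCosetFillable.{u} n s k p K' :=
  fun R _ _ hR M _ _ Z D a b β h1 h2 h3 h4 v hv huv =>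
    (h R hR M Z D a b β h1 h2 h3 h4 v hv huv).mono hK

/-- Finitely many constants have a common bound. -/
lemma exists_common_bound {A : ℕ → ℝ → Prop} (hA : ∀ j K K', K ≤ K' → A j K → A j K') (p : ℕ)
    (h : ∀ j ≤ p, ∃ K : ℝ, 0 ≤ K ∧ A j K) : ∃ K : ℝ, 0 ≤ K ∧ ∀ j ≤ p, A j K := by
  choose! κ h0 h1 using h
  have hmem : ∀ j ≤ p, j ∈ Finset.range (p + 1) := fun j hj => Finset.mem_range.2 (by omega)
  have hnn : ∀ j ∈ Finset.range (p + 1), 0 ≤ κ j := fun j hj =>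
    h0 j (by have := Finset.mem_range.1 hj; omega)
  exact ⟨∑ j ∈ Finset.range (p + 1), κ j, Finset.sum_nonneg hnn, fun j hj =>
    hA j _ _ (Finset.single_le_sum hnn (hmem j hj)) (h1 j hj)⟩

/-- The coset contains two cosets of rank one less, which are separated by the last coordinate. -/
lemma exists_cosetFillable_succ {n s k p : ℕ}
    (h : ∀ j ≤ p, ∃ K : ℝ, 0 ≤ K ∧ TwoCosetFillable.{u} n s (k + j) (p - j) K) :
    ∃ K : ℝ, 0 ≤ K ∧ CosetFillable.{u} (n + 1) s k p K := by
  obtain ⟨K, hK, h⟩ := exists_common_bound (fun j K K' hKK h => h.mono hKK) p h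
  obtain ⟨K', hK', hlink⟩ := fillable_of_links.{u} p K hK
  refine ⟨K', hK', fun R _ _ hR M _ _ Z D a v hv huv => ?_⟩
  set b := D.f (Fin.last n)
  set a' := a - MulOpposite.op (D.φ (Fin.last n) a) • b with ha'
  set X := D.coset a
  set X' := D.init.coset a' ∪ D.init.coset (a' + b)
  have hb : D.φ (Fin.last n) b = 1 := by simp [b, D.dual]
  have hX : X' ⊆ X := by
    have h1 : ∀ i, D.init.f i ∈ D.span := fun i => D.f_mem _
    refine Set.union_subset (SplitBasis.coset_subset h1 ?_) (SplitBasis.coset_subset h1 ?_)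
    · change a' - a ∈ D.span
      rw [ha', sub_sub_cancel_left]
      exact Submodule.neg_mem _ (Submodule.smul_mem _ _ (D.f_mem _))
    · change a' + b - a ∈ D.span
      rw [ha', sub_add, sub_sub_cancel_left]
      exact Submodule.neg_mem _ (Submodule.sub_mem _ (Submodule.smul_mem _ _ (D.f_mem _))
        (D.f_mem _))
  have key : ∀ w, (∀ x ∈ w, x ∈ X) → UnimodularMod R Z (w ++ v) → w.length ≤ p →
      Fillable (linkIn (unimodularWords R Z X v) X' w) (p - w.length) K := by
    intro w hwX hw hl
    rw [linkIn_unimodularWords hX hwX]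
    refine h w.length hl R hR M Z D.init a' b (D.φ (Fin.last n)) hb ?_ ?_ (D.vanish _) (w ++ v) ?_
      hw
    · simp [ha', hb]
    · intro i
      change D.φ (Fin.last n) (D.f i.castSucc) = 0
      rw [D.dual, if_neg (Fin.castSucc_lt_last i).ne']
    · rw [List.length_append, hv, add_comm]
  exact hlink M _ X' (sublistClosed_unimodularWords X v) (key [] (by simp) huv (Nat.zero_le _))
    fun x w _ hxw hl => key (x :: w) hxw.1 hxw.2 hl

/-- The complex of unimodular words in two cosets is built from the cone over the first coset with
apex `a + b`. A vector of the second coset is split off by `β`. -/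
lemma exists_twoCosetFillable_zero {n s p : ℕ}
    (h : ∀ j, j + 1 ≤ p → ∃ K : ℝ, 0 ≤ K ∧ CosetFillable.{u} n s j (p - (j + 1)) K) :
    ∃ K : ℝ, 0 ≤ K ∧ TwoCosetFillable.{u} n s 0 p K := by
  obtain ⟨K, hK, h⟩ := exists_common_bound
    (A := fun j K => j + 1 ≤ p → CosetFillable.{u} n s j (p - (j + 1)) K)
    (fun j K K' hKK h hj => (h hj).mono hKK) p (fun j _ => by
      by_cases hj : j + 1 ≤ p
      · obtain ⟨K, hK, h⟩ := h j hj
        exact ⟨K, hK, fun _ => h⟩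
      · exact ⟨0, le_rfl, fun h => absurd h hj⟩)
  obtain ⟨K', hK', hcone⟩ := fillable_of_cone.{u} p K hK
  refine ⟨K', hK', fun R _ _ hR M _ _ Z D a b β hb ha hf hZ v hv _ => ?_⟩
  obtain rfl := List.length_eq_zero_iff.1 hv
  set X := D.coset a
  have hβX : ∀ x ∈ X, β x = 0 := fun x hx => (D.map_eq_of_mem_coset hf hx).trans ha
  have hβY : ∀ x ∈ D.coset (a + b), β x = 1 := fun x hx => by
    rw [D.map_eq_of_mem_coset hf hx, map_add, ha, hb, zero_add]
  have hy := D.mem_coset_self (a + b)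
  refine hcone M _ X (a + b) (sublistClosed_unimodularWords _ _) ?_ ?_ ?_
  · intro hX
    have := hβX _ hX
    rw [hβY _ hy] at this
    exact one_ne_zero this
  · rintro w ⟨hw1, hw2⟩ hwX
    refine ⟨fun x hx => ?_, ?_⟩
    · rcases List.mem_append.1 hx with hx | hx
      · exact hw1 x hx
      · rw [List.mem_singleton.1 hx]
        exact Or.inr hy
    · rw [List.append_nil] at hw2 ⊢
      exact hw2.append_singleton (hβY _ hy) (fun x hx => hβX x (hwX x hx)) hZ
  · intro x w hxX hxw hl
    have hxY : β x = 1 := hβY x ((hxw.1 x (by simp)).resolve_left hxX)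
    have huw := hxw.2
    rw [List.append_nil, ← List.nil_append (x :: w), unimodularMod_append_cons_iff hxY hZ,
      List.nil_append] at huw
    rw [linkIn_unimodularWords Set.subset_union_left hxw.1, List.append_nil,
      ← List.nil_append (x :: w), unimodularWords_append_cons hxY hZ, List.nil_append]
    exact h w.length (by omega) hl R hR M _ (D.insert hf hZ hxY) a w rfl huw

lemma fillable_zero_of_mem {V : Type*} {F : Set (List V)} {x : V} (hx : [x] ∈ F) :
    Fillable F 0 1 := by
  intro c hc _
  have hc' : c = Finsupp.single [] (c []) := by
    ext w
    by_cases hw : w = []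
    · simp [hw]
    · rw [Finsupp.single_apply, if_neg (Ne.symm hw)]
      by_contra h0
      exact hw (List.length_eq_zero_iff.1 (hc (Finsupp.mem_support_iff.2 h0)).2)
  refine ⟨Finsupp.single [x] (c []), ?_, ?_, ?_⟩
  · apply single_mem_supported
    exact ⟨hx, rfl⟩
  · conv_rhs => rw [hc']
    simp [wordBoundary]
  · rw [hc']
    simp

/-- If the rank is at least the stable rank, every unimodular vector can be extended by a vector of
the second coset: correct `a + b` such that a functional that splits off `v` vanishes on it. -/
lemma twoCosetFillable_one_zero {n s : ℕ} (hs : s ≤ n) : TwoCosetFillable.{u} n s 1 0 1 := by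
  intro R _ _ hR M _ _ Z D a b β hb ha hf hZ v hv huv
  obtain ⟨v, rfl⟩ := List.length_eq_one_iff.1 hv
  obtain ⟨ψ, hψ, -, hψZ⟩ := huv.2 v (by simp)
  obtain ⟨D', c, hDf, hc⟩ := D.exists_unimodular_coordinates hR hs hψ hψZ
  set y := a + b - ∑ i, MulOpposite.op (D'.φ i (a + b)) • D'.f i with hy
  have hφy : ∀ i, D'.φ i y = 0 := by
    intro i
    simp [hy, map_sum, D'.dual]
  have hβy : β y = 1 := by
    simp [hy, map_sum, hDf, hf, ha, hb]
  have hyY : y ∈ D.coset (a + b) := by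
    change y - (a + b) ∈ D.span
    rw [hy, sub_sub_cancel_left]
    refine Submodule.neg_mem _ (Submodule.sum_mem _ fun i _ => Submodule.smul_mem _ _ ?_)
    rw [hDf]
    exact D.f_mem i
  set θ : M →ₗ[Rᵐᵒᵖ] R := ∑ i, c i • D'.φ i with hθ
  have hθv : θ v = 1 := by simpa [hθ, LinearMap.sum_apply] using hc
  have hθy : θ y = 0 := by simp [hθ, LinearMap.sum_apply, hφy]
  have hθZ : ∀ z ∈ Z, θ z = 0 := fun z hz => by
    simp [hθ, LinearMap.sum_apply, D'.vanish _ z hz]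
  refine fillable_zero_of_mem (x := y) ⟨by simpa using Or.inr hyY, ?_⟩
  refine UnimodularMod.append_singleton (β := θ) ⟨by simp, fun x hx => ?_⟩ hθv (by simpa) hθZ
  obtain rfl := List.mem_singleton.1 hx
  exact ⟨β, hβy, fun x' hx' hne => absurd (List.mem_singleton.1 hx') hne, hZ⟩

/-- If the rank exceeds the stable rank, the first vector of the given list can be split off at the
expense of one dimension of the cosets. -/
lemma exists_twoCosetFillable_succ {n s k p : ℕ} (hs : s ≤ n)
    (h : ∀ j ≤ p, ∃ K : ℝ, 0 ≤ K ∧ TwoCosetFillable.{u} n s (k + j) (p - j) K) :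
    ∃ K : ℝ, 0 ≤ K ∧ TwoCosetFillable.{u} (n + 1) s (k + 1) p K := by
  obtain ⟨K, hK, h⟩ := exists_common_bound (fun j K K' hKK h => h.mono hKK) p h
  obtain ⟨K', hK', hlink⟩ := fillable_of_links.{u} p K hK
  refine ⟨K', hK', fun R _ _ hR M _ _ Z D a b β hb ha hf hZ v hv huv => ?_⟩
  obtain ⟨v, vs, rfl⟩ := List.exists_cons_of_length_eq_add_one hv
  obtain ⟨ψ, hψ, -, hψZ⟩ := huv.2 v (by simp)
  obtain ⟨D', θ, γ, hD', hγ, hθγ, hθv, hθf, hθZ⟩ := D.exists_split_off hR hs hψ hψZ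
  set X := D.coset a ∪ D.coset (a + b)
  set a' := a - MulOpposite.op (θ a) • γ with ha'
  set b' := b - MulOpposite.op (θ b) • γ with hb'
  set X' := D'.coset a' ∪ D'.coset (a' + b')
  have hβ0 : ∀ x ∈ D.span, β x = 0 := by
    have h1 : D.span ≤ LinearMap.ker β := by
      rw [SplitBasis.span, Submodule.span_le]
      rintro _ ⟨i, rfl⟩
      exact hf i
    exact fun x hx => h1 hx
  have hX : X' ⊆ X := by
    refine Set.union_subset_union (SplitBasis.coset_subset hD' ?_)
      (SplitBasis.coset_subset hD' ?_)
    · change a' - a ∈ D.span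
      rw [ha', sub_sub_cancel_left]
      exact Submodule.neg_mem _ (Submodule.smul_mem _ _ hγ)
    · change a' + b' - (a + b) ∈ D.span
      rw [ha', hb', sub_add_sub_comm, sub_sub_cancel_left]
      exact Submodule.neg_mem _ (Submodule.add_mem _ (Submodule.smul_mem _ _ hγ)
        (Submodule.smul_mem _ _ hγ))
  have key : ∀ w, (∀ x ∈ w, x ∈ X) → UnimodularMod R Z (w ++ v :: vs) → w.length ≤ p →
      Fillable (linkIn (unimodularWords R Z X (v :: vs)) X' w) (p - w.length) K := by
    intro w hwX hw hl
    rw [linkIn_unimodularWords hX hwX, unimodularWords_append_cons hθv hθZ]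
    refine h w.length hl R hR M _ D' a' b' (β - β v • θ) ?_ ?_ ?_ ?_ (w ++ vs) ?_ ?_
    · simp [hθγ, hb', hβ0 γ hγ, hb]
    · simp [hθγ, ha', hβ0 γ hγ, ha]
    · intro i
      simp [hθf, hβ0 _ (hD' i)]
    · rintro z (rfl | hz)
      · simp [hθv]
      · simp [hθZ z hz, hZ z hz]
    · simp only [List.length_cons, Nat.add_right_cancel_iff] at hv
      rw [List.length_append, hv, add_comm]
    · exact (unimodularMod_append_cons_iff hθv hθZ w vs).1 hw
  exact hlink M _ X' (sublistClosed_unimodularWords X _) (key [] (by simp) huv (Nat.zero_le _))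
    fun x w _ hxw hl => key (x :: w) hxw.1 hxw.2 hl

/-- The simultaneous induction over the rank. In rank `0` nothing is claimed for one coset, because
`1 ≤ s`. -/
lemma exists_fillable {s : ℕ} (hs : 1 ≤ s) (n : ℕ) :
    (∀ k p, p + s + k ≤ n → ∃ K : ℝ, 0 ≤ K ∧ CosetFillable.{u} n s k p K) ∧
    ∀ k p, p + s + k ≤ n + 1 → ∃ K : ℝ, 0 ≤ K ∧ TwoCosetFillable.{u} n s k p K := by
  induction n with
  | zero =>
    have h1 : ∀ k p, p + s + k ≤ 0 → ∃ K : ℝ, 0 ≤ K ∧ CosetFillable.{u} 0 s k p K :=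
      fun k p h => by omega
    refine ⟨h1, fun k p h => ?_⟩
    obtain ⟨rfl, rfl⟩ : k = 0 ∧ p = 0 := by omega
    exact exists_twoCosetFillable_zero fun j hj => by omega
  | succ n ih =>
    have h1 : ∀ k p, p + s + k ≤ n + 1 → ∃ K : ℝ, 0 ≤ K ∧ CosetFillable.{u} (n + 1) s k p K :=
      fun k p h => exists_cosetFillable_succ fun j hj => ih.2 (k + j) (p - j) (by omega)
    refine ⟨h1, fun k p h => ?_⟩
    cases k with
    | zero => exact exists_twoCosetFillable_zero fun j hj => h1 j _ (by omega)
    | succ k =>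
      by_cases hsn : s ≤ n
      · exact exists_twoCosetFillable_succ hsn fun j hj => ih.2 (k + j) (p - j) (by omega)
      · obtain ⟨rfl, rfl⟩ : k = 0 ∧ p = 0 := by omega
        exact ⟨1, zero_le_one, twoCosetFillable_one_zero (by omega)⟩

end Induction

/-! ### Uniform acyclicity of the posets of unimodular sequences -/

section Posets

lemma fillable_flagsOf_unimodularWords (p : ℕ) {K : ℝ} (hK : 0 ≤ K) : ∃ K' : ℝ, 0 ≤ K' ∧
    ∀ (R : Type u) [Ring R] (M : Type u) [AddCommGroup M] [Module Rᵐᵒᵖ M] (X : Set M) (v : List M),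
      UnimodularMod R ∅ v → Fillable (unimodularWords R ∅ X v) p K →
        Fillable (flagsOf (unimodularWords R ∅ X v)) p K' := by
  obtain ⟨K', hK', h⟩ := fillable_flagsOf.{u} p K hK
  refine ⟨K', hK', fun R _ M _ _ X v hv hfill => ?_⟩
  have : Inhabited M := ⟨0⟩
  exact h M _ (sublistClosed_unimodularWords X v) ⟨by simp, hv⟩
    (fun w hw => hw.2.1.sublist (List.sublist_append_left w v)) hfill

/-- A constant for all flag complexes of unimodular words in a coset, uniform in the degree. -/
lemma exists_bound_coset (n s k : ℕ) : ∃ K : ℝ, 1 ≤ s → ∀ p : ℕ, p + s + k ≤ n →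
    ∀ (R : Type u) [Ring R] [Nontrivial R], StableRange R (s + 1) →
    ∀ (M : Type u) [AddCommGroup M] [Module Rᵐᵒᵖ M] (D : SplitBasis R (∅ : Set M) n) (a : M)
      (v : List M), v.length = k → UnimodularMod R ∅ v →
      Fillable (flagsOf (unimodularWords R ∅ (D.coset a) v)) p K := by
  by_cases hs : 1 ≤ s
  swap
  · exact ⟨0, fun h => absurd h hs⟩
  obtain ⟨K, -, hK⟩ := exists_common_bound (p := n) (A := fun p K => p + s + k ≤ n →
    ∀ (R : Type u) [Ring R] [Nontrivial R], StableRange R (s + 1) →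
    ∀ (M : Type u) [AddCommGroup M] [Module Rᵐᵒᵖ M] (D : SplitBasis R (∅ : Set M) n) (a : M)
      (v : List M), v.length = k → UnimodularMod R ∅ v →
      Fillable (flagsOf (unimodularWords R ∅ (D.coset a) v)) p K)
    (fun p K K' hKK h hp R _ _ hR M _ _ D a v hv huv => (h hp R hR M D a v hv huv).mono hKK)
    (fun p _ => by
      by_cases hp : p + s + k ≤ n
      · obtain ⟨K, hK0, hK⟩ := (exists_fillable.{u} hs n).1 k p hp
        obtain ⟨K', hK0', h⟩ := fillable_flagsOf_unimodularWords.{u} p hK0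
        exact ⟨K', hK0', fun _ R _ _ hR M _ _ D a v hv huv =>
          h R M _ v huv (hK R hR M ∅ D a v hv huv)⟩
      · exact ⟨0, le_rfl, fun h => absurd h hp⟩)
  exact ⟨K, fun _ p hp => hK p (by omega) hp⟩

/-- A constant for all flag complexes of unimodular words in two cosets, uniform in the degree. -/
lemma exists_bound_twoCosets (n s k : ℕ) : ∃ K : ℝ, 1 ≤ s → ∀ p : ℕ, p + s + k ≤ n + 1 →
    ∀ (R : Type u) [Ring R] [Nontrivial R], StableRange R (s + 1) →
    ∀ (M : Type u) [AddCommGroup M] [Module Rᵐᵒᵖ M] (D : SplitBasis R (∅ : Set M) n) (a b : M)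
      (β : M →ₗ[Rᵐᵒᵖ] R), β b = 1 → β a = 0 → (∀ i, β (D.f i) = 0) →
      ∀ v : List M, v.length = k → UnimodularMod R ∅ v →
      Fillable (flagsOf (unimodularWords R ∅ (D.coset a ∪ D.coset (a + b)) v)) p K := by
  by_cases hs : 1 ≤ s
  swap
  · exact ⟨0, fun h => absurd h hs⟩
  obtain ⟨K, -, hK⟩ := exists_common_bound (p := n + 1) (A := fun p K => p + s + k ≤ n + 1 →
    ∀ (R : Type u) [Ring R] [Nontrivial R], StableRange R (s + 1) →
    ∀ (M : Type u) [AddCommGroup M] [Module Rᵐᵒᵖ M] (D : SplitBasis R (∅ : Set M) n) (a b : M)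
      (β : M →ₗ[Rᵐᵒᵖ] R), β b = 1 → β a = 0 → (∀ i, β (D.f i) = 0) →
      ∀ v : List M, v.length = k → UnimodularMod R ∅ v →
      Fillable (flagsOf (unimodularWords R ∅ (D.coset a ∪ D.coset (a + b)) v)) p K)
    (fun p K K' hKK h hp R _ _ hR M _ _ D a b β hb ha hf v hv huv =>
      (h hp R hR M D a b β hb ha hf v hv huv).mono hKK)
    (fun p _ => by
      by_cases hp : p + s + k ≤ n + 1
      · obtain ⟨K, hK0, hK⟩ := (exists_fillable.{u} hs n).2 k p hp
        obtain ⟨K', hK0', h⟩ := fillable_flagsOf_unimodularWords.{u} p hK0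
        exact ⟨K', hK0', fun _ R _ _ hR M _ _ D a b β hb ha hf v hv huv =>
          h R M _ v huv (hK R hR M ∅ D a b β hb ha hf (by simp) v hv huv)⟩
      · exact ⟨0, le_rfl, fun h => absurd h hp⟩)
  exact ⟨K, fun _ p hp => hK p (by omega) hp⟩

variable {R : Type u} [Ring R] [Nontrivial R] {M : Type u} [AddCommGroup M] [Module Rᵐᵒᵖ M]

lemma wordsOf_inter_appendLink (X : Set M) {v : OrderedSeq M} (hv : v ∈ unimodularSeqs R M) :
    wordsOf (orderedSeqs X ∩ appendLink (unimodularSeqs R M) v) =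
      unimodularWords R ∅ X v.toList := by
  ext w
  constructor
  · rintro (rfl | ⟨x, ⟨hx, y, hy, hyx⟩, rfl⟩)
    · exact ⟨by simp, (isUnimodular_iff _).1 hv⟩
    · refine ⟨hx, ?_⟩
      rw [← hyx]
      exact (isUnimodular_iff _).1 hy
  · rintro ⟨h1, h2⟩
    by_cases hw : w = []
    · exact Or.inl hw
    · refine Or.inr ⟨⟨w, hw, h2.1.sublist (List.sublist_append_left _ _)⟩, ⟨h1, ?_⟩, rfl⟩
      exact ⟨⟨w ++ v.toList, by simp [hw], h2.1⟩, (isUnimodular_iff _).2 h2, rfl⟩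

lemma wordsOf_inter_unimodularSeqs (X : Set M) :
    wordsOf (orderedSeqs X ∩ unimodularSeqs R M) = unimodularWords R ∅ X [] := by
  ext w
  constructor
  · rintro (rfl | ⟨x, ⟨hx, hxu⟩, rfl⟩)
    · exact ⟨by simp, by simp, by simp⟩
    · refine ⟨hx, ?_⟩
      rw [List.append_nil]
      exact (isUnimodular_iff _).1 hxu
  · rintro ⟨h1, h2⟩
    rw [List.append_nil] at h2
    by_cases hw : w = []
    · exact Or.inl hw
    · exact Or.inr ⟨⟨w, hw, h2.1⟩, ⟨h1, (isUnimodular_iff _).2 h2⟩, rfl⟩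

/-- The first `n` standard basis vectors of `R^∞`. -/
def stdBasis (R : Type*) [Ring R] (n : ℕ) : SplitBasis R (∅ : Set (ℕ →₀ R)) n where
  f i := Finsupp.single (i : ℕ) 1
  φ i := Finsupp.lapply (i : ℕ)
  dual i j := by simp [Finsupp.single_apply, Fin.ext_iff, eq_comm]
  vanish := by simp

/-- The standard basis of `R^n`. -/
def piBasis (R : Type*) [Ring R] (n : ℕ) : SplitBasis R (∅ : Set (Fin n → R)) n where
  f i := Pi.single i 1
  φ i := LinearMap.proj i
  dual i j := by simp [Pi.single_apply]
  vanish := by simp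

lemma span_stdBasis (R : Type*) [Ring R] (n : ℕ) :
    (stdBasis R n).span = Finsupp.supported R Rᵐᵒᵖ {i : ℕ | i < n} := by
  apply le_antisymm
  · rw [SplitBasis.span, Submodule.span_le]
    rintro _ ⟨i, rfl⟩
    exact Finsupp.single_mem_supported _ _ i.2
  · intro x hx
    rw [← Finsupp.sum_single x]
    refine Submodule.sum_mem _ fun i hi => ?_
    have h1 : Finsupp.single i (x i) = MulOpposite.op (x i) • (stdBasis R n).f ⟨i, hx hi⟩ := by
      simp [stdBasis]
    rw [h1]
    exact Submodule.smul_mem _ _ (SplitBasis.f_mem _ _)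

lemma coset_eq (R : Type*) [Ring R] (n : ℕ) (δ : R) :
    coset R n δ = (stdBasis R n).coset (Finsupp.single n δ) := by
  ext x
  constructor
  · rintro ⟨v, hv, rfl⟩
    rwa [SplitBasis.mem_coset, add_sub_cancel_right, span_stdBasis]
  · intro hx
    refine ⟨x - Finsupp.single n δ, ?_, (sub_add_cancel _ _).symm⟩
    rw [← span_stdBasis]
    exact hx

lemma twoCosets_eq (R : Type*) [Ring R] (n : ℕ) (δ : R) :
    twoCosets R n δ = (stdBasis R n).coset (Finsupp.single n δ) ∪
      (stdBasis R n).coset (Finsupp.single n δ + Finsupp.single (n + 1) 1) := by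
  rw [twoCosets, coset_eq]
  congr 1
  ext x
  constructor
  · rintro ⟨y, hy, rfl⟩
    rwa [SplitBasis.mem_coset, add_sub_add_right_eq_sub]
  · intro hx
    refine ⟨x - Finsupp.single (n + 1) 1, ?_, (sub_add_cancel _ _).symm⟩
    rw [SplitBasis.mem_coset, sub_sub, add_comm (Finsupp.single (n + 1) 1)]
    exact hx

lemma coset_piBasis (R : Type*) [Ring R] (n : ℕ) : (piBasis R n).coset 0 = Set.univ := by
  ext x
  simp only [Set.mem_univ, iff_true]
  have hx : x - 0 = ∑ i, MulOpposite.op (x i) • (piBasis R n).f i := by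
    ext j
    simp [piBasis, Finset.sum_apply, Pi.single_apply]
  rw [SplitBasis.mem_coset, hx]
  exact Submodule.sum_mem _ fun i _ => Submodule.smul_mem _ _ (SplitBasis.f_mem _ _)

end Posets

end UniformAcyclicity

end

open UniformAcyclicity in
theorem mainTheorem6 :
    ∃ (K₁ : ℕ → ℕ → ℝ) (K₂ : ℕ → ℕ → ℕ → ℝ) (K₃ : ℕ → ℕ → ℝ) (K₄ : ℕ → ℕ → ℕ → ℝ),
      ∀ (R : Type u) [Ring R] [Nontrivial R] (s : ℕ), stableRank R = (s : ℕ∞) → ∀ n : ℕ,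
        (∀ δ : R, δ = 0 ∨ δ = 1 →
          UniformlyAcyclicWith
              ↥(orderedSeqs (coset R n δ) ∩ unimodularSeqs R (ℕ →₀ R))
              ((n : ℤ) - s - 1) (K₁ n s) ∧
          (∀ v ∈ unimodularSeqs R (ℕ →₀ R), ∀ k : ℕ, v.toList.length = k →
            UniformlyAcyclicWith
              ↥(orderedSeqs (coset R n δ) ∩ appendLink (unimodularSeqs R (ℕ →₀ R)) v)
              ((n : ℤ) - s - 1 - k) (K₂ n s k)) ∧
          UniformlyAcyclicWith
              ↥(orderedSeqs (twoCosets R n δ) ∩ unimodularSeqs R (ℕ →₀ R))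
              ((n : ℤ) - s) (K₃ n s) ∧
          (∀ v ∈ unimodularSeqs R (ℕ →₀ R), ∀ k : ℕ, v.toList.length = k →
            UniformlyAcyclicWith
              ↥(orderedSeqs (twoCosets R n δ) ∩ appendLink (unimodularSeqs R (ℕ →₀ R)) v)
              ((n : ℤ) - s - k) (K₄ n s k))) ∧
        UniformlyAcyclicWith ↥(unimodularSeqs R (Fin n → R)) ((n : ℤ) - s - 1) (K₁ n s) := by
  choose K hK using exists_bound_coset.{u}
  choose L hL using exists_bound_twoCosets.{u}
  refine ⟨fun n s => K n s 0, K, fun n s => L n s 0, L, fun R _ _ s hs n => ?_⟩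
  obtain ⟨hs1, hR⟩ := stableRange_of_stableRank_eq hs
  have hnil : ∀ (M : Type u) [AddCommGroup M] [Module Rᵐᵒᵖ M], UnimodularMod R (∅ : Set M) [] :=
    fun M _ _ => ⟨List.nodup_nil, by simp⟩
  -- the functional that separates the two cosets
  have hβa : ∀ δ : R, (Finsupp.lapply (n + 1) : (ℕ →₀ R) →ₗ[Rᵐᵒᵖ] R) (Finsupp.single n δ) = 0 :=
    fun δ => by simp
  have hβb : (Finsupp.lapply (n + 1) : (ℕ →₀ R) →ₗ[Rᵐᵒᵖ] R) (Finsupp.single (n + 1) 1) = 1 := by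
    simp
  have hβf : ∀ i, (Finsupp.lapply (n + 1) : (ℕ →₀ R) →ₗ[Rᵐᵒᵖ] R) ((stdBasis R n).f i) = 0 := by
    intro i
    have : (i : ℕ) ≠ n + 1 := by omega
    simp [stdBasis, this]
  refine ⟨fun δ _ => ⟨?_, ?_, ?_, ?_⟩, ?_⟩
  · refine uniformlyAcyclicWith_of_fillable fun p hp => ?_
    rw [wordsOf_inter_unimodularSeqs, coset_eq]
    exact hK n s 0 hs1 p (by omega) R hR _ _ _ [] rfl (hnil _)
  · rintro v hv k hvk
    refine uniformlyAcyclicWith_of_fillable fun p hp => ?_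
    rw [wordsOf_inter_appendLink _ hv, coset_eq]
    exact hK n s k hs1 p (by omega) R hR _ _ _ _ hvk ((isUnimodular_iff _).1 hv)
  · refine uniformlyAcyclicWith_of_fillable fun p hp => ?_
    rw [wordsOf_inter_unimodularSeqs, twoCosets_eq]
    exact hL n s 0 hs1 p (by omega) R hR _ _ _ _ _ hβb (hβa δ) hβf [] rfl (hnil _)
  · rintro v hv k hvk
    refine uniformlyAcyclicWith_of_fillable fun p hp => ?_
    rw [wordsOf_inter_appendLink _ hv, twoCosets_eq]
    exact hL n s k hs1 p (by omega) R hR _ _ _ _ _ hβb (hβa δ) hβf _ hvk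
      ((isUnimodular_iff _).1 hv)
  · refine uniformlyAcyclicWith_of_fillable fun p hp => ?_
    have huniv : unimodularSeqs R (Fin n → R) =
        orderedSeqs ((piBasis R n).coset 0) ∩ unimodularSeqs R (Fin n → R) := by
      rw [coset_piBasis]
      ext w
      simp [orderedSeqs]
    rw [huniv, wordsOf_inter_unimodularSeqs]
    exact hK n s 0 hs1 p (by omega) R hR _ _ _ [] rfl (hnil _)
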